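/- **Setting.** Let $k\ge 1$ and let $\mathbf n=(n_1,\dots,n_k)$, $\mathbf m=(m_1,\dots,m_k)$ be tuples of positive integers. For each $i$ let $f_i=\sum_{\alpha\in\mathbb F_{n_i}^+}a_{i,\alpha}Z_\alpha$ be a positive regular free holomorphic function in $n_i$ noncommuting variables: $a_{i,\alpha}\ge 0$, $a_{i,g_0}=0$, $a_{i,g_j}>0$ for $1\le j\le n_i$, and $\limsup_{q\to\infty}\big(\sum_{|\alpha|=q}|a_{i,\alpha}|^2\big)^{1/2q}<\infty$, where $\mathbb F_{n_i}^+$ is the free unital semigroup with generators $g_1,\dots,g_{n_i}$ and identity $g_0$. All Hilbert spaces are complex. For a tuple $X_i=(X_{i,1},\dots,X_{i,n_i})$ in $B(\mathcal H)$ put $\Phi_{f_i,X_i}(Y)=\sum_{|\alpha|\ge1}a_{i,\alpha}X_{i,\alpha}YX_{i,\alpha}^*$ (convergence in the weak operator topology), and for $\mathbf X=(X_1,\dots,X_k)$ and $\mathbf p\in\mathbb Z_+^k$ put $\mathbf\Delta^{\mathbf p}_{\mathbf f,\mathbf X}=(id-\Phi_{f_1,X_1})^{p_1}\cdots(id-\Phi_{f_k,X_k})^{p_k}$.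 The noncommutative polydomain $\mathbf D^{\mathbf m}_{\mathbf f}(\mathcal H)$ is the set of those $\mathbf X$ for which the entries of $X_i$ commute with the entries of $X_{i'}$ whenever $i\neq i'$, each $\Phi_{f_i,X_i}(I)$ exists and is $\le I$, and $\mathbf\Delta^{(\epsilon_1m_1,\dots,\epsilon_km_k)}_{\mathbf f,\mathbf X}(I)\ge0$ for all $\epsilon\in\{0,1\}^k$. Let $b^{(m_i)}_{i,g_0}=1$ and $b^{(m_i)}_{i,\alpha}=\sum_{p=1}^{|\alpha|}\sum_{\gamma_1\cdots\gamma_p=\alpha,\,|\gamma_s|\ge1}a_{i,\gamma_1}\cdots a_{i,\gamma_p}\binom{p+m_i-1}{m_i-1}$ for $|\alpha|\ge1$. Let $F^2(H_{n_i})$ be the full Fock space with orthonormal basis $(e^i_\alpha)_{\alpha\in\mathbb F_{n_i}^+}$, and let $\mathbf F=F^2(H_{n_1})\otimes\cdots\otimes F^2(H_{n_k})$. The universal model $\mathbf W=(\mathbf W_{i,j})$ on $\mathbf F$ consists of the operators acting on the $i$-th factor by $e^i_\alpha\mapsto\sqrt{b^{(m_i)}_{i,\alpha}/b^{(m_i)}_{i,g_j\alpha}}\;e^i_{g_j\alpha}$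 and as the identity on the other factors. A bounded operator $M:\mathbf F\otimes\mathcal E\to\mathbf F\otimes\mathcal G$ is *multi-analytic* if $M(\mathbf W_{i,j}\otimes I_{\mathcal E})=(\mathbf W_{i,j}\otimes I_{\mathcal G})M$ for all $i,j$. For $\mathbf T\in\mathbf D^{\mathbf m}_{\mathbf f}(\mathcal H)$ put $\mathcal D_{\mathbf T}=\overline{\mathbf\Delta^{\mathbf m}_{\mathbf f,\mathbf T}(I)\mathcal H}$. The noncommutative Berezin kernel $\mathbf K_{\mathbf f,\mathbf T}:\mathcal H\to\mathbf F\otimes\mathcal D_{\mathbf T}$ is given by $$\mathbf K_{\mathbf f,\mathbf T}h=\sum_{\beta_i\in\mathbb F_{n_i}^+}\sqrt{b^{(m_1)}_{1,\beta_1}}\cdots\sqrt{b^{(m_k)}_{k,\beta_k}}\;e^1_{\beta_1}\otimes\cdots\otimes e^k_{\beta_k}\otimes\mathbf\Delta^{\mathbf m}_{\mathbf f,\mathbf T}(I)^{1/2}T_{1,\beta_1}^*\cdots T_{k,\beta_k}^*h .$$ We say that $\mathbf T$ *admits a characteristic function* if there are a Hilbert space $\mathcal E$ and a multi-analytic operator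 $\Psi:\mathbf F\otimes\mathcal E\to\mathbf F\otimes\mathcal D_{\mathbf T}$ with $\mathbf K_{\mathbf f,\mathbf T}\mathbf K_{\mathbf f,\mathbf T}^*+\Psi\Psi^*=I$. **Theorem.** Let $\mathcal H$ be a Hilbert space and $\mathbf T\in\mathbf D^{\mathbf m}_{\mathbf f}(\mathcal H)$. Then $\mathbf K_{\mathbf f,\mathbf T}$ is a well-defined bounded operator, and $\mathbf T$ admits a characteristic function if and only if $$\mathbf\Delta^{\mathbf p}_{\mathbf f,\mathbf W\otimes I}\big(I-\mathbf K_{\mathbf f,\mathbf T}\mathbf K_{\mathbf f,\mathbf T}^*\big)\ge0\qquad\text{for every }\mathbf p\in\mathbb Z_+^k\text{ with }\mathbf p\le\mathbf m .$$ Moreover, suppose that $\mathbf T$ admits a characteristic function. Put $Y=I-\mathbf K_{\mathbf f,\mathbf T}\mathbf K_{\mathbf f,\mathbf T}^*$ and $\mathcal M_{\mathbf T}=\overline{\operatorname{range}Y}$. Then there are unique bounded operators $A_{i,j}$ on $\mathcal M_{\mathbf T}$ with $A_{i,j}Y^{1/2}x=Y^{1/2}(\mathbf W_{i,j}^*\otimes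 I)x$ for all $x\in\mathbf F\otimes\mathcal D_{\mathbf T}$; the tuple $\mathbf M_{\mathbf T}=(A_{i,j}^*)$ belongs to $\mathbf D^{\mathbf m}_{\mathbf f}(\mathcal M_{\mathbf T})$, so that its Berezin kernel $\mathbf K_{\mathbf f,\mathbf M_{\mathbf T}}:\mathcal M_{\mathbf T}\to\mathbf F\otimes\mathcal D_{\mathbf M_{\mathbf T}}$ is a well-defined bounded operator; and $$\Theta_{\mathbf f,\mathbf T}:=Y^{1/2}\,\mathbf K_{\mathbf f,\mathbf M_{\mathbf T}}^*:\ \mathbf F\otimes\mathcal D_{\mathbf M_{\mathbf T}}\to\mathbf F\otimes\mathcal D_{\mathbf T}$$ is a multi-analytic operator with $\mathbf K_{\mathbf f,\mathbf T}\mathbf K_{\mathbf f,\mathbf T}^*+\Theta_{\mathbf f,\mathbf T}\Theta_{\mathbf f,\mathbf T}^*=I$. -/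

import Mathlib

open ContinuousLinearMap Filter

namespace NCPolydomain

noncomputable section

universe u

/-! ### Positive regular free holomorphic functions

A word in the free unital semigroup on `n` generators is a list of letters `j : Fin n`; the empty
list is the neutral element, concatenation is the product and `j :: α` is `g_j α`. -/

/-- A positive regular free holomorphic function `f = ∑_α a_α Z_α` in `n` noncommuting variables:
`a_α ≥ 0`, `a_{g_0} = 0`, `a_{g_j} > 0`, and
`limsup_q (∑_{|α| = q} |a_α|²)^{1/(2q)} < ∞`. -/
structure PosRegular (n : ℕ) where
  coeff : List (Fin n) → ℝ
  coeff_nonneg : ∀ α, 0 ≤ coeff α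
  coeff_nil : coeff [] = 0
  coeff_letter_pos : ∀ j, 0 < coeff [j]
  growth : limsup (fun q : ℕ =>
      (((∑ α : Fin q → Fin n, |coeff (List.ofFn α)| ^ 2) ^ (1 / (2 * (q : ℝ))) : ℝ) : EReal))
    atTop < ⊤

/-- The coefficients
`b_α^{(m)} = ∑_{γ_1 ⋯ γ_p = α, |γ_s| ≥ 1} a_{γ_1} ⋯ a_{γ_p} (p + m - 1 choose m - 1)`, `m ≥ 1`.
The factorizations of `α` into nonempty words are indexed by the compositions of `|α|`. The empty
word has exactly one (with `p = 0`), so that `b_{g_0}^{(m)} = 1`. -/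
def bCoeff {n : ℕ} (f : PosRegular n) (m : ℕ) (α : List (Fin n)) : ℝ :=
  ∑ c : Composition α.length,
    ((α.splitWrtComposition c).map f.coeff).prod * ((c.length + m - 1).choose (m - 1) : ℝ)

theorem bCoeff_nil {n : ℕ} (f : PosRegular n) (m : ℕ) : bCoeff f m [] = 1 := by
  have h : ∀ c : Composition 0, c.blocks = [] := fun c => by
    have := c.blocks_sum
    rcases hb : c.blocks with _ | ⟨x, l⟩
    · rfl
    · have hx := c.blocks_pos (i := x) (by simp [hb])
      rw [hb] at this
      simp at this
      omega
  unfold bCoeff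
  refine (Fintype.sum_eq_single (default : Composition ([] : List (Fin n)).length) ?_).trans ?_
  rotate_left
  · have h' : (default : Composition ([] : List (Fin n)).length).blocks = [] := h _
    simp [List.splitWrtComposition, h', List.splitWrtCompositionAux, Composition.length]
  · intro c hc
    exact absurd (Composition.ext ((h c).trans (h default).symm)) hc

theorem mul_bCoeff_le {n : ℕ} (f : PosRegular n) (m : ℕ) (j : Fin n) (α : List (Fin n)) :
    f.coeff [j] * bCoeff f m α ≤ bCoeff f m (j :: α) := by
  let φ : Composition α.length → Composition (j :: α).length := fun c =>
    ⟨1 :: c.blocks, by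
      intro i hi
      rcases List.mem_cons.1 hi with rfl | hi
      · exact Nat.one_pos
      · exact c.blocks_pos hi, by simp [c.blocks_sum, add_comm]⟩
  have hφ : Function.Injective φ := by
    intro c d h
    have := congrArg Composition.blocks h
    exact Composition.ext (by simpa [φ] using this)
  have hprod : ∀ L : List (List (Fin n)), 0 ≤ (L.map f.coeff).prod := fun L =>
    List.prod_nonneg (by
      intro a ha
      obtain ⟨γ, -, rfl⟩ := List.mem_map.1 ha
      exact f.coeff_nonneg γ)
  unfold bCoeff
  rw [Finset.mul_sum]
  calc
    _ ≤ ∑ c : Composition α.length,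
        ((((j :: α).splitWrtComposition (φ c)).map f.coeff).prod
          * (((φ c).length + m - 1).choose (m - 1) : ℝ)) := by
      refine Finset.sum_le_sum fun c _ => ?_
      have h1 : (j :: α).splitWrtComposition (φ c) = [j] :: α.splitWrtComposition c := by
        simp [List.splitWrtComposition, φ, List.splitWrtCompositionAux_cons]
      have h2 : (φ c).length = c.length + 1 := by simp [φ, Composition.length]
      rw [h1, h2, List.map_cons, List.prod_cons, mul_assoc]
      refine mul_le_mul_of_nonneg_left ?_ (f.coeff_nonneg _)
      refine mul_le_mul_of_nonneg_left ?_ (hprod _)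
      exact_mod_cast Nat.choose_le_choose _ (by omega)
    _ = ∑ c ∈ Finset.univ.image φ,
        (((j :: α).splitWrtComposition c).map f.coeff).prod
          * ((c.length + m - 1).choose (m - 1) : ℝ) :=
      (Finset.sum_image (f := fun c : Composition (j :: α).length =>
        (((j :: α).splitWrtComposition c).map f.coeff).prod
          * ((c.length + m - 1).choose (m - 1) : ℝ)) (fun _ _ _ _ h => hφ h)).symm
    _ ≤ _ := Finset.sum_le_sum_of_subset_of_nonneg (Finset.subset_univ _)
      (fun c _ _ => mul_nonneg (hprod _) (Nat.cast_nonneg _))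

theorem bCoeff_pos {n : ℕ} (f : PosRegular n) (m : ℕ) (α : List (Fin n)) : 0 < bCoeff f m α := by
  induction α with
  | nil => rw [bCoeff_nil]; exact one_pos
  | cons j α ih => exact (mul_pos (f.coeff_letter_pos j) ih).trans_le (mul_bCoeff_le f m j α)

/-- The weight `√b_α^{(m)} / √b_{g_j α}^{(m)}`. -/
def weight {n : ℕ} (f : PosRegular n) (m : ℕ) (j : Fin n) (α : List (Fin n)) : ℝ :=
  √(bCoeff f m α) / √(bCoeff f m (j :: α))

theorem weight_nonneg {n : ℕ} (f : PosRegular n) (m : ℕ) (j : Fin n) (α : List (Fin n)) :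
    0 ≤ weight f m j α := div_nonneg (Real.sqrt_nonneg _) (Real.sqrt_nonneg _)

theorem weight_le {n : ℕ} (f : PosRegular n) (m : ℕ) (j : Fin n) (α : List (Fin n)) :
    weight f m j α ≤ (√(f.coeff [j]))⁻¹ := by
  unfold weight
  rw [← Real.sqrt_div (bCoeff_pos f m α).le, ← Real.sqrt_inv]
  refine Real.sqrt_le_sqrt ?_
  rw [div_le_iff₀ (bCoeff_pos f m _), inv_mul_eq_div, le_div_iff₀ (f.coeff_letter_pos j), mul_comm]
  exact mul_bCoeff_le f m j α

/-! ### The maps `Φ_{f,X}` and the noncommutative polydomain -/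

section Domain

variable {H : Type u} [NormedAddCommGroup H] [InnerProductSpace ℂ H] [CompleteSpace H]

/-- `X_α = X_{j_1} ⋯ X_{j_p}` for `α = g_{j_1} ⋯ g_{j_p}`, and `X_{g_0} = I`. -/
def wordOp {n : ℕ} (X : Fin n → H →L[ℂ] H) (α : List (Fin n)) : H →L[ℂ] H :=
  (α.map X).prod

/-- The terms `a_α X_α Y X_α^*`, in `B(H)` with the weak operator topology. -/
def phiTerm {n : ℕ} (f : PosRegular n) (X : Fin n → H →L[ℂ] H) (Y : H →L[ℂ] H)
    (α : List (Fin n)) : H →WOT[ℂ] H :=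
  ContinuousLinearMapWOT.ofCLM ((f.coeff α : ℂ) • (wordOp X α * Y * adjoint (wordOp X α)))

/-- `Φ_{f,X}(Y) = ∑_α a_α X_α Y X_α^*`, a sum in the weak operator topology. (The empty word
contributes `0`.) -/
def phi {n : ℕ} (f : PosRegular n) (X : Fin n → H →L[ℂ] H) (Y : H →L[ℂ] H) : H →L[ℂ] H :=
  (∑' α, phiTerm f X Y α).toCLM

/-- The defect mapping
`Δ_{f,X}^p = (id - Φ_{f_1,X_1})^{p_1} ∘ ⋯ ∘ (id - Φ_{f_k,X_k})^{p_k}` on `B(H)`. -/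
def defectMap {k : ℕ} {n : Fin k → ℕ} (f : ∀ i, PosRegular (n i))
    (X : ∀ i, Fin (n i) → H →L[ℂ] H) (p : Fin k → ℕ) (Y : H →L[ℂ] H) : H →L[ℂ] H :=
  (List.finRange k).foldr (fun i Z => (fun V => V - phi (f i) (X i) V)^[p i] Z) Y

/-- Membership of the `k`-tuple `X` in the noncommutative polydomain `D_f^m(H)`: the entries of
`X_i` commute with those of `X_{i'}` for `i ≠ i'`, each `Φ_{f_i,X_i}(I)` exists and is at most `I`,
and `Δ_{f,X}^{(ε_1 m_1, …, ε_k m_k)}(I) ≥ 0` for all `ε ∈ {0,1}^k`. -/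
structure MemPolydomain {k : ℕ} {n : Fin k → ℕ} (f : ∀ i, PosRegular (n i)) (m : Fin k → ℕ)
    (X : ∀ i, Fin (n i) → H →L[ℂ] H) : Prop where
  commute : ∀ i i', i ≠ i' → ∀ j j', Commute (X i j) (X i' j')
  summable : ∀ i, Summable (phiTerm (f i) (X i) 1)
  phi_le_one : ∀ i, phi (f i) (X i) 1 ≤ 1
  defect_nonneg : ∀ ε : Fin k → Fin 2, 0 ≤ defectMap f X (fun i => (ε i : ℕ) * m i) 1

/-- The closure of the range of an operator. -/
def closedRange (A : H →L[ℂ] H) : Submodule ℂ H :=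
  (LinearMap.range (A : H →ₗ[ℂ] H)).topologicalClosure

instance (A : H →L[ℂ] H) : CompleteSpace (closedRange A) :=
  inferInstanceAs (CompleteSpace (LinearMap.range (A : H →ₗ[ℂ] H)).topologicalClosure)

/-- The positive square root `A^{1/2}` of an operator `A ≥ 0`. -/
def opSqrt (A : H →L[ℂ] H) : H →L[ℂ] H := CFC.sqrt A

theorem sqrt_mem_closedRange (A : H →L[ℂ] H) (x : H) : opSqrt A x ∈ closedRange A := by
  unfold opSqrt
  by_cases hA : 0 ≤ A
  · have hs : IsSelfAdjoint (CFC.sqrt A) := (CFC.sqrt_nonneg A).isSelfAdjoint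
    have hsym : ∀ x y : H, inner ℂ (CFC.sqrt A x) y = inner ℂ x (CFC.sqrt A y) := fun x y => by
      rw [← ContinuousLinearMap.adjoint_inner_right, hs.adjoint_eq]
    have hsq : ∀ y, CFC.sqrt A (CFC.sqrt A y) = A y := fun y =>
      congrArg (fun B : H →L[ℂ] H => B y) (CFC.sqrt_mul_sqrt_self A hA)
    unfold closedRange
    rw [← Submodule.orthogonal_orthogonal_eq_closure, Submodule.mem_orthogonal]
    intro y hy
    have h0 : inner ℂ (A y) y = 0 := hy (A y) ⟨y, rfl⟩
    rw [← hsq, hsym, inner_self_eq_zero] at h0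
    rw [← inner_conj_symm, hsym, h0, inner_zero_right, map_zero]
  · have : CFC.sqrt A = 0 := cfcₙ_apply_of_not_predicate A hA
    rw [this]
    exact Submodule.zero_mem _

/-- `A^{1/2}`, for `A ≥ 0`, as an operator into the closure of the range of `A`. -/
def sqrtInto (A : H →L[ℂ] H) : H →L[ℂ] closedRange A :=
  (opSqrt A).codRestrict (closedRange A) (sqrt_mem_closedRange A)

end Domain

/-! ### The universal model and multi-analytic operators -/

section Fock

variable {k : ℕ} {n : Fin k → ℕ}

/-- The Hilbert space `F²(H_{n_1}) ⊗ ⋯ ⊗ F²(H_{n_k}) ⊗ E`, in the coordinates given by the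
orthonormal basis `e_β = e^1_{β_1} ⊗ ⋯ ⊗ e^k_{β_k}` of the first `k` factors: the vector
`∑_β e_β ⊗ x_β` is the square summable family `(x_β)_β` in `E`, and `e_β ⊗ x` is
`lp.single 2 β x`. -/
abbrev FockTensor (n : Fin k → ℕ) (E : Type u) [NormedAddCommGroup E] [InnerProductSpace ℂ E] :
    Type u :=
  lp (fun _ : (∀ i, List (Fin (n i))) => E) 2

variable {E : Type u} [NormedAddCommGroup E] [InnerProductSpace ℂ E]

theorem update_cons_injective (i : Fin k) (j : Fin (n i)) :
    Function.Injective
      (fun β : (∀ i, List (Fin (n i))) => Function.update β i (j :: β i)) := by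
  intro β γ h
  funext l
  have hl := congrFun h l
  by_cases hli : l = i
  · subst hli
    simpa using hl
  · simpa [Function.update_of_ne hli] using hl

/-- The family `γ ↦ w_γ x_{g_j γ}` (the letter `j` being put in front of the `i`-th word). -/
def backwardFun (f : ∀ i, PosRegular (n i)) (m : Fin k → ℕ) (i : Fin k) (j : Fin (n i))
    (x : (∀ i, List (Fin (n i))) → E) (γ : ∀ i, List (Fin (n i))) : E :=
  (weight (f i) (m i) j (γ i) : ℂ) • x (Function.update γ i (j :: γ i))

theorem backwardFun_norm_sq_le (f : ∀ i, PosRegular (n i)) (m : Fin k → ℕ) (i : Fin k)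
    (j : Fin (n i)) (x : (∀ i, List (Fin (n i))) → E) (γ : ∀ i, List (Fin (n i))) :
    ‖backwardFun f m i j x γ‖ ^ (2 : ℝ)
      ≤ (√((f i).coeff [j]))⁻¹ ^ (2 : ℝ) * ‖x (Function.update γ i (j :: γ i))‖ ^ (2 : ℝ) := by
  rw [← Real.mul_rpow (by positivity) (norm_nonneg _)]
  refine Real.rpow_le_rpow (norm_nonneg _) ?_ (by norm_num)
  rw [backwardFun, norm_smul, Complex.norm_real, Real.norm_of_nonneg (weight_nonneg _ _ _ _)]
  exact mul_le_mul_of_nonneg_right (weight_le _ _ _ _) (norm_nonneg _)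

theorem backwardFun_summable (f : ∀ i, PosRegular (n i)) (i : Fin k)
    (j : Fin (n i)) (x : FockTensor n E) :
    Summable (fun γ => (√((f i).coeff [j]))⁻¹ ^ (2 : ℝ)
      * ‖x (Function.update γ i (j :: γ i))‖ ^ (2 : ℝ)) := by
  have h : Summable fun β => ‖x β‖ ^ (2 : ℝ) := by
    simpa using (lp.hasSum_norm (p := 2) (by norm_num) x).summable
  exact (h.comp_injective (update_cons_injective i j)).mul_left _

theorem backwardFun_memℓp (f : ∀ i, PosRegular (n i)) (m : Fin k → ℕ) (i : Fin k)
    (j : Fin (n i)) (x : FockTensor n E) : Memℓp (backwardFun f m i j x) 2 := by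
  refine memℓp_gen ?_
  simp only [ENNReal.toReal_ofNat]
  exact Summable.of_nonneg_of_le (fun γ => by positivity)
    (fun γ => backwardFun_norm_sq_le f m i j x γ) (backwardFun_summable f i j x)

/-- The weighted backward shift `e_{g_j γ} ⊗ x ↦ w_γ e_γ ⊗ x`, the adjoint of the universal
model. -/
def backwardShift (f : ∀ i, PosRegular (n i)) (m : Fin k → ℕ) (i : Fin k) (j : Fin (n i)) :
    FockTensor n E →L[ℂ] FockTensor n E :=
  LinearMap.mkContinuous
    { toFun := fun x => ⟨backwardFun f m i j x, backwardFun_memℓp f m i j x⟩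
      map_add' := fun x y => by ext γ; exact smul_add _ _ _
      map_smul' := fun c x => by ext γ; exact smul_comm _ _ _ }
    (√((f i).coeff [j]))⁻¹ (fun x => by
      have hx : HasSum (fun β => ‖x β‖ ^ (2 : ℝ)) (‖x‖ ^ (2 : ℝ)) := by
        simpa using lp.hasSum_norm (p := 2) (by norm_num) x
      set z : FockTensor n E := ⟨backwardFun f m i j x, backwardFun_memℓp f m i j x⟩ with hz
      have hzs : HasSum (fun β => ‖z β‖ ^ (2 : ℝ)) (‖z‖ ^ (2 : ℝ)) := by
        simpa using lp.hasSum_norm (p := 2) (by norm_num) z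
      have h1 : ‖z‖ ^ (2 : ℝ) ≤ ((√((f i).coeff [j]))⁻¹ * ‖x‖) ^ (2 : ℝ) := by
        rw [Real.mul_rpow (by positivity) (norm_nonneg _), ← hzs.tsum_eq, ← hx.tsum_eq]
        refine (hzs.summable.tsum_le_tsum (fun γ => backwardFun_norm_sq_le f m i j x γ)
          (backwardFun_summable f i j x)).trans ?_
        rw [tsum_mul_left]
        refine mul_le_mul_of_nonneg_left ?_ (by positivity)
        exact tsum_comp_le_tsum_of_inj hx.summable (fun β => by positivity)
          (update_cons_injective i j)
      exact (Real.rpow_le_rpow_iff (norm_nonneg _) (by positivity) (by norm_num)).1 h1)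

variable [CompleteSpace E]

/-- The operator `W_{i,j} ⊗ I_E` of the universal model: it multiplies the `i`-th word by `g_j` on
the left, with weight; see `universalModel_single`. -/
def universalModel (f : ∀ i, PosRegular (n i)) (m : Fin k → ℕ) (E : Type u)
    [NormedAddCommGroup E] [InnerProductSpace ℂ E] [CompleteSpace E]
    (i : Fin k) (j : Fin (n i)) : FockTensor n E →L[ℂ] FockTensor n E :=
  adjoint (backwardShift f m i j)

/-- `(W_{i,j} ⊗ I)(e_β ⊗ x) = (√b_{i,β_i}^{(m_i)} / √b_{i,g_j β_i}^{(m_i)}) e_{β'} ⊗ x`, where `β'`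
is `β` with its `i`-th word `β_i` replaced by `g_j β_i`. -/
theorem universalModel_single (f : ∀ i, PosRegular (n i)) (m : Fin k → ℕ)
    (i : Fin k) (j : Fin (n i)) (β : ∀ i, List (Fin (n i))) (x : E) :
    universalModel f m E i j (lp.single 2 β x)
      = ((√(bCoeff (f i) (m i) (β i)) / √(bCoeff (f i) (m i) (j :: β i)) : ℝ) : ℂ)
        • lp.single 2 (Function.update β i (j :: β i)) x := by
  refine ext_inner_right ℂ fun y => ?_
  rw [universalModel, adjoint_inner_left, lp.inner_single_left, inner_smul_left,
    lp.inner_single_left]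
  change inner ℂ x (backwardFun f m i j y β) = _
  rw [backwardFun, inner_smul_right, Complex.conj_ofReal]
  rfl

/-- A bounded operator `M` is multi-analytic if `M (W_{i,j} ⊗ I) = (W_{i,j} ⊗ I) M` for all
`i, j`. -/
def IsMultiAnalytic {G : Type u} [NormedAddCommGroup G] [InnerProductSpace ℂ G] [CompleteSpace G]
    (f : ∀ i, PosRegular (n i)) (m : Fin k → ℕ) (M : FockTensor n E →L[ℂ] FockTensor n G) : Prop :=
  ∀ i j, M ∘L universalModel f m E i j = universalModel f m G i j ∘L M

end Fock

/-! ### The Berezin kernel and the characteristic function -/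

section Kernel

variable {k : ℕ} {n : Fin k → ℕ} {H : Type u} [NormedAddCommGroup H] [InnerProductSpace ℂ H]
  [CompleteSpace H]

/-- The closure of the range of the defect operator `Δ_{f,T}^m(I)`. -/
abbrev defectSpace (f : ∀ i, PosRegular (n i)) (m : Fin k → ℕ)
    (T : ∀ i, Fin (n i) → H →L[ℂ] H) : Submodule ℂ H :=
  closedRange (defectMap f T m 1)

/-- `K` is the Berezin kernel of `T`:
`K h = ∑_β √b_{1,β_1}^{(m_1)} ⋯ √b_{k,β_k}^{(m_k)} e_β ⊗ Δ_{f,T}^m(I)^{1/2} T_{1,β_1}^* ⋯ T_{k,β_k}^* h`.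
-/
def IsBerezinKernel (f : ∀ i, PosRegular (n i)) (m : Fin k → ℕ) (T : ∀ i, Fin (n i) → H →L[ℂ] H)
    (K : H →L[ℂ] FockTensor n (defectSpace f m T)) : Prop :=
  ∀ (h : H) (β : ∀ i, List (Fin (n i))),
    K h β = ((∏ i, √(bCoeff (f i) (m i) (β i)) : ℝ) : ℂ) •
      sqrtInto (defectMap f T m 1)
        (((List.finRange k).map fun i => adjoint (wordOp (T i) (β i))).prod h)

open Classical in
/-- The Berezin kernel `K_{f,T}`: the bounded operator given by the formula of `IsBerezinKernel`.
(At most one operator satisfies this formula. The value `0` is a placeholder for tuples outside the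
polydomain.) -/
def berezinKernel (f : ∀ i, PosRegular (n i)) (m : Fin k → ℕ) (T : ∀ i, Fin (n i) → H →L[ℂ] H) :
    H →L[ℂ] FockTensor n (defectSpace f m T) :=
  if h : ∃ K, IsBerezinKernel f m T K then h.choose else 0

/-- The operator `I - K_{f,T} K_{f,T}^*`. -/
def kernelDefect (f : ∀ i, PosRegular (n i)) (m : Fin k → ℕ) (T : ∀ i, Fin (n i) → H →L[ℂ] H) :
    FockTensor n (defectSpace f m T) →L[ℂ] FockTensor n (defectSpace f m T) :=
  1 - berezinKernel f m T ∘L adjoint (berezinKernel f m T)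

/-- `T` has a characteristic function: there are a Hilbert space `E` and a multi-analytic operator
`Ψ` with `K_{f,T} K_{f,T}^* + Ψ Ψ^* = I`. -/
def HasCharacteristicFunction (f : ∀ i, PosRegular (n i)) (m : Fin k → ℕ)
    (T : ∀ i, Fin (n i) → H →L[ℂ] H) : Prop :=
  ∃ (E : Type u) (_ : NormedAddCommGroup E) (_ : InnerProductSpace ℂ E) (_ : CompleteSpace E)
    (Ψ : FockTensor n E →L[ℂ] FockTensor n (defectSpace f m T)),
    IsMultiAnalytic f m Ψ ∧
      berezinKernel f m T ∘L adjoint (berezinKernel f m T) + Ψ ∘L adjoint Ψ = 1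

/-- The space `M_T`, the closure of the range of `I - K_{f,T} K_{f,T}^*`. -/
abbrev modelSpace (f : ∀ i, PosRegular (n i)) (m : Fin k → ℕ) (T : ∀ i, Fin (n i) → H →L[ℂ] H) :
    Submodule ℂ (FockTensor n (defectSpace f m T)) :=
  closedRange (kernelDefect f m T)

/-- `A` is the operator `A_{i,j}` on `M_T`, which is given by
`A (I - K K^*)^{1/2} x = (I - K K^*)^{1/2} (W_{i,j}^* ⊗ I) x`. -/
def IsModelAdjoint (f : ∀ i, PosRegular (n i)) (m : Fin k → ℕ) (T : ∀ i, Fin (n i) → H →L[ℂ] H)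
    (i : Fin k) (j : Fin (n i)) (A : modelSpace f m T →L[ℂ] modelSpace f m T) : Prop :=
  ∀ x : FockTensor n (defectSpace f m T),
    A (sqrtInto (kernelDefect f m T) x) =
      sqrtInto (kernelDefect f m T) (adjoint (universalModel f m (defectSpace f m T) i j) x)

open Classical in
/-- The `k`-tuple `M_T` of operators `M_{i,j} = A_{i,j}^*` on the space `M_T`. (The placeholder `0`
is used when `A_{i,j}` does not exist as a bounded operator.) -/
def modelTuple (f : ∀ i, PosRegular (n i)) (m : Fin k → ℕ) (T : ∀ i, Fin (n i) → H →L[ℂ] H)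
    (i : Fin k) (j : Fin (n i)) : modelSpace f m T →L[ℂ] modelSpace f m T :=
  if h : ∃ A, IsModelAdjoint f m T i j A then adjoint h.choose else 0

/-- The operator `Θ_{f,T} = (I - K_{f,T} K_{f,T}^*)^{1/2} K_{f,M_T}^*`. -/
def theta (f : ∀ i, PosRegular (n i)) (m : Fin k → ℕ) (T : ∀ i, Fin (n i) → H →L[ℂ] H) :
    FockTensor n (defectSpace f m (modelTuple f m T)) →L[ℂ] FockTensor n (defectSpace f m T) :=
  (opSqrt (kernelDefect f m T) ∘L (modelSpace f m T).subtypeL) ∘L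
    adjoint (berezinKernel f m (modelTuple f m T))

end Kernel

end

end NCPolydomain

open NCPolydomain

/-! Write `Y = I - K K^*`, `Δ_W^p` for the defect maps of the universal model, and `b^{(m)}` for the
coefficients of `(1 - f)^{-m}`.

Necessity. If `Y = Ψ Ψ^*` with `Ψ` multi-analytic, then `Ψ` passes through every `Φ_{f_i,W_i}`, so
`Δ_W^p(Y) = Ψ Δ_W^p(I) Ψ^*` (`defectFold_intertwine`). The operator `Δ_W^p(I)` is diagonal with
entries `∏ b^{(m_i - p_i)} / b^{(m_i)}`, hence positive for `p ≤ m`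
(`universalModel_defectMap_nonneg`).

Sufficiency. Let `R` be `Y^{1/2}`, regarded as an operator into the closure of its range, so that
`R^* R = Y`. Positivity of `Y - Φ_{f_i,W_i}(Y)` makes `R x ↦ R W_{i,j}^* x` well defined and
bounded; these are the operators `A_{i,j}`. With `X = (A_{i,j}^*)`, the adjoint `R^*` intertwines
`X` with `W`, whence `R^* Δ_X^p(I) R = Δ_W^p(Y) ≥ 0`; by density of the range of `R`, the tuple `X`
lies in the polydomain (`IsCompression.memPolydomain`). Its Berezin kernel `K_X` is isometric
(`IsCompression.norm_berezinKernel`), so `Θ = R^* K_X^*` satisfies `Θ Θ^* = R^* R = Y`, and it is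
multi-analytic because both factors intertwine.

Boundedness and isometry of Berezin kernels rest on one formal identity: since `b^{(m)}` inverts `(1
- f)^m`, the sum `∑_α b^{(m)}_α X_α ((id - Φ)^m V) X_α^*` should return `V`. Cut off at length `N`,
it gives at most `V` when the intermediate defects are positive (`RowContraction.sum_invCoeff_le`),
and exactly `V` on vectors killed by all longer words (`RowContraction.sum_invCoeff_eq`). The first
yields `‖K h‖ ≤ ‖h‖`; the second, on the dense set of truncated vectors, the isometry. The
intermediate positivity comes from an averaging argument (`RowContraction.sub_phi_nonneg`). -/

namespace NCPolydomain

universe u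

/-! ### Factorizations of words and the coefficients of `(1 - f)^{-m}` -/

section Words

/-- The factorizations of a word into two words. -/
def splits {ι : Type*} [DecidableEq ι] (β : List ι) : Finset (List ι × List ι) :=
  (Finset.range (β.length + 1)).image fun s => (β.take s, β.drop s)

theorem mem_splits {ι : Type*} [DecidableEq ι] {β : List ι} {p : List ι × List ι} :
    p ∈ splits β ↔ p.1 ++ p.2 = β := by
  unfold splits
  simp only [Finset.mem_image, Finset.mem_range]
  constructor
  · rintro ⟨s, -, rfl⟩
    simp
  · rintro rfl
    exact ⟨p.1.length, by simp, by simp⟩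

theorem splits_fst_injOn {ι : Type*} [DecidableEq ι] (β : List ι) :
    Set.InjOn Prod.fst (splits β : Set (List ι × List ι)) := by
  rintro ⟨a, b⟩ hp ⟨c, d⟩ hq h
  simp only [Finset.mem_coe, mem_splits] at hp hq h
  subst h
  rw [← hq] at hp
  simpa using hp

/-- Both sides run over the factorizations of `β` into three words. This is the associativity of the
convolution product of free power series. -/
theorem sum_splits_assoc {ι : Type*} [DecidableEq ι] (β : List ι)
    (g : List ι → List ι → List ι → ℝ) :
    ∑ p ∈ splits β, ∑ q ∈ splits p.1, g q.1 q.2 p.2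
      = ∑ p ∈ splits β, ∑ q ∈ splits p.2, g p.1 q.1 q.2 := by
  rw [Finset.sum_sigma', Finset.sum_sigma']
  refine Finset.sum_bij' (fun x _ => ⟨(x.2.1, x.2.2 ++ x.1.2), (x.2.2, x.1.2)⟩)
    (fun x _ => ⟨(x.1.1 ++ x.2.1, x.2.2), (x.1.1, x.2.1)⟩) ?_ ?_ ?_ ?_ ?_
  · rintro ⟨⟨a, b⟩, c, d⟩ h
    simp only [Finset.mem_sigma, mem_splits] at h ⊢
    obtain ⟨h1, rfl⟩ := h
    simpa using h1
  · rintro ⟨⟨a, b⟩, c, d⟩ h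
    simp only [Finset.mem_sigma, mem_splits] at h ⊢
    obtain ⟨h1, rfl⟩ := h
    simpa using h1
  · rintro ⟨⟨a, b⟩, c, d⟩ h
    simp only [Finset.mem_sigma, mem_splits] at h
    obtain ⟨h1, rfl⟩ := h
    rfl
  · rintro ⟨⟨a, b⟩, c, d⟩ h
    simp only [Finset.mem_sigma, mem_splits] at h
    obtain ⟨h1, rfl⟩ := h
    rfl
  · rintro ⟨⟨a, b⟩, c, d⟩ h
    rfl

/-- The words of length at most `N`. -/
noncomputable def words (n N : ℕ) : Finset (List (Fin n)) :=
  (List.finite_length_le (Fin n) N).toFinset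

theorem mem_words {n N : ℕ} {α : List (Fin n)} : α ∈ words n N ↔ α.length ≤ N := by
  simp [words]

theorem sum_words_splits {n : ℕ} (N : ℕ) (g : List (Fin n) → List (Fin n) → ℝ) :
    ∑ β ∈ words n N, ∑ p ∈ splits β, g p.1 p.2
      = ∑ α ∈ words n N, ∑ γ ∈ words n (N - α.length), g α γ := by
  rw [Finset.sum_sigma', Finset.sum_sigma']
  refine Finset.sum_bij' (fun x _ => ⟨x.2.1, x.2.2⟩)
    (fun x _ => ⟨x.1 ++ x.2, (x.1, x.2)⟩) ?_ ?_ ?_ ?_ ?_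
  · rintro ⟨a, c, d⟩ h
    simp only [Finset.mem_sigma, mem_splits, mem_words] at h ⊢
    obtain ⟨h1, rfl⟩ := h
    simp at h1
    omega
  · rintro ⟨a, c⟩ h
    simp only [Finset.mem_sigma, mem_splits, mem_words, List.length_append] at h ⊢
    exact ⟨by omega, trivial⟩
  · rintro ⟨a, c, d⟩ h
    simp only [Finset.mem_sigma, mem_splits] at h
    obtain ⟨h1, rfl⟩ := h
    rfl
  · rintro ⟨a, c⟩ h
    rfl
  · rintro ⟨a, c, d⟩ h
    rfl

variable {n : ℕ} (f : PosRegular n)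

/-- The coefficients of the power `f ^ q`. -/
def powCoeff : ℕ → List (Fin n) → ℝ
  | 0, β => if β = [] then 1 else 0
  | q + 1, β => ∑ p ∈ splits β, f.coeff p.1 * powCoeff q p.2

theorem powCoeff_nonneg (q : ℕ) (β : List (Fin n)) : 0 ≤ powCoeff f q β := by
  induction q generalizing β with
  | zero => unfold powCoeff; split_ifs <;> norm_num
  | succ q ih => exact Finset.sum_nonneg fun p _ => mul_nonneg (f.coeff_nonneg _) (ih _)

/-- Since `f` has no constant term, `f ^ q` starts in degree `q`. This is why the series for `(1 -
f)^{-m}` is a finite sum at each word. -/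
theorem powCoeff_eq_zero {q : ℕ} {β : List (Fin n)} (h : β.length < q) : powCoeff f q β = 0 := by
  induction q generalizing β with
  | zero => omega
  | succ q ih =>
    refine Finset.sum_eq_zero fun p hp => ?_
    rw [mem_splits] at hp
    rcases hp1 : p.1 with _ | ⟨j, α⟩
    · rw [f.coeff_nil, zero_mul]
    · rw [ih, mul_zero]
      rw [← hp, hp1] at h
      simp at h
      omega

/-- Powers of `f` commute with `f` even though the variables do not. The left recursion serves the
universal model, which acts on prefixes; the right one serves the partial sums for general tuples.
-/
theorem powCoeff_succ_right (q : ℕ) (β : List (Fin n)) :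
    powCoeff f (q + 1) β = ∑ p ∈ splits β, powCoeff f q p.1 * f.coeff p.2 := by
  induction q generalizing β with
  | zero =>
    have h1 : ([], β) ∈ splits β := mem_splits.2 rfl
    have h2 : (β, []) ∈ splits β := mem_splits.2 (by simp)
    rw [powCoeff, Finset.sum_eq_single_of_mem _ h2, Finset.sum_eq_single_of_mem _ h1]
    · simp [powCoeff]
    · rintro ⟨a, b⟩ hp hne
      rw [mem_splits] at hp
      have : a ≠ [] := by rintro rfl; exact hne (by simpa using hp)
      simp [powCoeff, this]
    · rintro ⟨a, b⟩ hp hne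
      rw [mem_splits] at hp
      have : b ≠ [] := by rintro rfl; exact hne (by simpa using hp)
      simp [powCoeff, this]
  | succ q ih =>
    have h := sum_splits_assoc β fun a b c => f.coeff a * powCoeff f q b * f.coeff c
    calc
      _ = ∑ p ∈ splits β, f.coeff p.1 * powCoeff f (q + 1) p.2 := rfl
      _ = ∑ p ∈ splits β, ∑ r ∈ splits p.2, f.coeff p.1 * powCoeff f q r.1 * f.coeff r.2 := by
        simp_rw [ih, Finset.mul_sum, mul_assoc]
      _ = ∑ p ∈ splits β, (∑ r ∈ splits p.1, f.coeff r.1 * powCoeff f q r.2) * f.coeff p.2 := by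
        simp_rw [← h, Finset.sum_mul]

/-- The coefficients of `(1 - f)^{-m}`, for every `m ≥ 0`. -/
def invCoeff (m : ℕ) (β : List (Fin n)) : ℝ :=
  ∑ q ∈ Finset.range (β.length + 1), (m.multichoose q : ℝ) * powCoeff f q β

theorem invCoeff_nonneg (m : ℕ) (β : List (Fin n)) : 0 ≤ invCoeff f m β :=
  Finset.sum_nonneg fun _ _ => mul_nonneg (Nat.cast_nonneg _) (powCoeff_nonneg _ _ _)

theorem invCoeff_eq_sum_range (m : ℕ) {β : List (Fin n)} {M : ℕ} (h : β.length < M) :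
    invCoeff f m β = ∑ q ∈ Finset.range M, (m.multichoose q : ℝ) * powCoeff f q β := by
  refine Finset.sum_subset (fun q => by simp; omega) fun q _ hq => ?_
  rw [powCoeff_eq_zero f (by simpa [Nat.lt_succ_iff] using hq), mul_zero]

theorem invCoeff_zero (β : List (Fin n)) : invCoeff f 0 β = if β = [] then 1 else 0 := by
  rw [invCoeff, Finset.sum_range_succ']
  simp [powCoeff]

/-- Pascal's rule for `multichoose`, that is `(1 - f)^{-(m+1)} = (1 - f)^{-m} + f (1 - f)^{-(m+1)}`
with the last term still expanded in powers of `f`. -/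
theorem invCoeff_succ_aux (m : ℕ) (β : List (Fin n)) :
    invCoeff f (m + 1) β = invCoeff f m β
      + ∑ q ∈ Finset.range (β.length + 1),
        ((m + 1).multichoose q : ℝ) * powCoeff f (q + 1) β := by
  rw [invCoeff_eq_sum_range f (m + 1) (M := β.length + 2) (by omega),
    invCoeff_eq_sum_range f m (M := β.length + 2) (by omega), Finset.sum_range_succ',
    Finset.sum_range_succ' (fun q => (m.multichoose q : ℝ) * powCoeff f q β)]
  simp only [Nat.multichoose_succ_succ, Nat.cast_add, add_mul, Finset.sum_add_distrib,
    Nat.multichoose_zero_right]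
  ring

theorem invCoeff_succ_left (m : ℕ) (β : List (Fin n)) :
    invCoeff f (m + 1) β = invCoeff f m β
      + ∑ p ∈ splits β, f.coeff p.1 * invCoeff f (m + 1) p.2 := by
  rw [invCoeff_succ_aux]
  congr 1
  simp_rw [powCoeff, Finset.mul_sum]
  rw [Finset.sum_comm]
  refine Finset.sum_congr rfl fun p hp => ?_
  rw [mem_splits] at hp
  rw [invCoeff_eq_sum_range f (m + 1) (M := β.length + 1) (by rw [← hp]; simp),
    Finset.mul_sum]
  exact Finset.sum_congr rfl fun q _ => by ring

theorem invCoeff_succ_right (m : ℕ) (β : List (Fin n)) :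
    invCoeff f (m + 1) β = invCoeff f m β
      + ∑ p ∈ splits β, invCoeff f (m + 1) p.1 * f.coeff p.2 := by
  rw [invCoeff_succ_aux]
  congr 1
  simp_rw [powCoeff_succ_right, Finset.mul_sum]
  rw [Finset.sum_comm]
  refine Finset.sum_congr rfl fun p hp => ?_
  rw [mem_splits] at hp
  rw [invCoeff_eq_sum_range f (m + 1) (M := β.length + 1) (by rw [← hp]; simp),
    Finset.sum_mul]
  exact Finset.sum_congr rfl fun q _ => by ring

/-- The sum over all factorizations of `β` into nonempty words, weighted by the number of
factors. -/
def compSum (w : ℕ → ℝ) (β : List (Fin n)) : ℝ :=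
  ∑ c : Composition β.length, ((β.splitWrtComposition c).map f.coeff).prod * w c.length

theorem compSum_nil (w : ℕ → ℝ) : compSum f w [] = w 0 := by
  have h : ∀ c : Composition 0, c.blocks = [] := fun c => by
    have := c.blocks_sum
    rcases hb : c.blocks with _ | ⟨x, l⟩
    · rfl
    · have hx := c.blocks_pos (i := x) (by simp [hb])
      rw [hb] at this
      simp at this
      omega
  unfold compSum
  refine (Fintype.sum_eq_single (default : Composition ([] : List (Fin n)).length) ?_).trans ?_
  · intro c hc
    exact absurd (Composition.ext ((h c).trans (h default).symm)) hc
  · have h' : (default : Composition ([] : List (Fin n)).length).blocks = [] := h _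
    simp [List.splitWrtComposition, h', List.splitWrtCompositionAux, Composition.length]

/-- A composition of a nonempty word is its first block together with a composition of the rest;
removing the block shifts the weight by one. Splittings with an empty first word are harmless
because `f` has no constant term. -/
theorem compSum_of_ne_nil (w : ℕ → ℝ) {β : List (Fin n)} (hβ : β ≠ []) :
    compSum f w β = ∑ p ∈ splits β, f.coeff p.1 * compSum f (fun q => w (q + 1)) p.2 := by
  symm
  have h0 : ∀ p ∈ splits β, p ∉ (splits β).filter (fun p => p.1 ≠ []) →
      f.coeff p.1 * compSum f (fun q => w (q + 1)) p.2 = 0 := by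
    intro p hp hp'
    have : p.1 = [] := by simpa [hp] using hp'
    rw [this, f.coeff_nil, zero_mul]
  rw [← Finset.sum_subset (Finset.filter_subset (fun p => p.1 ≠ []) _) h0]
  unfold compSum
  simp_rw [Finset.mul_sum]
  rw [Finset.sum_sigma']
  refine Finset.sum_bij (fun x hx => ⟨x.1.1.length :: x.2.blocks, ?_, ?_⟩) ?_ ?_ ?_ ?_
  · intro i hi
    simp only [Finset.mem_sigma, Finset.mem_filter] at hx
    rcases List.mem_cons.1 hi with rfl | hi
    · exact List.length_pos_iff.2 hx.1.2
    · exact x.2.blocks_pos hi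
  · simp only [Finset.mem_sigma, Finset.mem_filter, mem_splits] at hx
    rw [List.sum_cons, x.2.blocks_sum, ← hx.1.1, List.length_append]
  · simp
  · rintro ⟨⟨a, b⟩, c⟩ h ⟨⟨a', b'⟩, c'⟩ h' heq
    simp only [Finset.mem_sigma, Finset.mem_filter, mem_splits] at h h'
    have hb := congrArg Composition.blocks heq
    simp only [List.cons.injEq] at hb
    obtain ⟨rfl, rfl⟩ := List.append_inj (h.1.1.trans h'.1.1.symm) hb.1
    have : c = c' := Composition.ext hb.2
    rw [this]
  · intro c _
    rcases hb : c.blocks with _ | ⟨x, t⟩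
    · have := c.blocks_sum
      rw [hb] at this
      exact absurd (List.length_eq_zero_iff.1 this.symm) hβ
    · have hs := c.blocks_sum
      have hx := c.blocks_pos (i := x) (by simp [hb])
      rw [hb, List.sum_cons] at hs
      refine ⟨⟨(β.take x, β.drop x), ⟨t, fun {i} hi => c.blocks_pos (by simp [hb, hi]), ?_⟩⟩, ?_, ?_⟩
      · rw [List.length_drop]; omega
      · simp only [Finset.mem_sigma, Finset.mem_filter, mem_splits, List.take_append_drop,
          Finset.mem_univ, and_true, true_and, ne_eq, List.take_eq_nil_iff, hβ, or_false]
        omega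
      · refine Composition.ext ?_
        simp only [hb, List.length_take, List.cons.injEq, and_true]
        omega
  · rintro ⟨⟨a, b⟩, c⟩ h
    simp only [Finset.mem_sigma, Finset.mem_filter, mem_splits] at h
    obtain ⟨⟨rfl, -⟩, -⟩ := h
    simp [List.splitWrtComposition, List.splitWrtCompositionAux_cons, Composition.length, mul_assoc]

theorem compSum_eq (w : ℕ → ℝ) (β : List (Fin n)) {M : ℕ} (h : β.length < M) :
    compSum f w β = ∑ q ∈ Finset.range M, w q * powCoeff f q β := by
  induction M generalizing w β with
  | zero => omega
  | succ M ih =>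
    rw [Finset.sum_range_succ']
    rcases eq_or_ne β [] with rfl | hβ
    · rw [compSum_nil, Finset.sum_eq_zero]
      · simp [powCoeff]
      · intro q _
        rw [powCoeff_eq_zero f (by simp), mul_zero]
    · rw [compSum_of_ne_nil f w hβ, show powCoeff f 0 β = 0 by simp [powCoeff, hβ], mul_zero,
        add_zero]
      simp_rw [powCoeff, Finset.mul_sum]
      rw [Finset.sum_comm]
      refine Finset.sum_congr rfl fun p hp => ?_
      rcases hp1 : p.1 with _ | ⟨j, α⟩
      · simp [f.coeff_nil]
      · rw [mem_splits, hp1] at hp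
        rw [ih _ p.2 (by rw [← hp] at h; simp at h; omega), Finset.mul_sum]
        exact Finset.sum_congr rfl fun q _ => by ring

/-- The hypothesis `1 ≤ m` matters: at `m = 0` the truncated subtraction gives every binomial in
`bCoeff` the value `1`, whereas `invCoeff` correctly yields the coefficients of the constant `1`.
The value at `m = 0` is needed to start inductions and for defects of full order. -/
theorem bCoeff_eq_invCoeff {m : ℕ} (hm : 1 ≤ m) (β : List (Fin n)) :
    bCoeff f m β = invCoeff f m β := by
  have h := compSum_eq f (fun q => ((q + m - 1).choose (m - 1) : ℝ)) β (Nat.lt_succ_self _)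
  refine h.trans (Finset.sum_congr rfl fun q _ => ?_)
  rw [Nat.multichoose_eq, show m + q - 1 = q + (m - 1) by omega,
    show q + m - 1 = q + (m - 1) by omega, ← Nat.choose_symm_add]

end Words

/-! ### Quadratic forms and families of operators -/

section Forms

variable {H : Type*} [NormedAddCommGroup H] [InnerProductSpace ℂ H]

/-- The quadratic form `x ↦ Re ⟨V x, x⟩`. -/
noncomputable def quad (V : H →L[ℂ] H) (x : H) : ℝ := (inner ℂ x (V x)).re

theorem quad_sub (V U : H →L[ℂ] H) (x : H) : quad (V - U) x = quad V x - quad U x := by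
  simp [quad]

theorem quad_one (x : H) : quad (1 : H →L[ℂ] H) x = ‖x‖ ^ 2 := by
  change (inner ℂ x x).re = _
  rw [inner_self_eq_norm_sq_to_K]
  norm_cast

theorem quad_apply_zero (V : H →L[ℂ] H) : quad V 0 = 0 := by simp [quad]

theorem abs_quad_le (V : H →L[ℂ] H) (x : H) : |quad V x| ≤ ‖V‖ * ‖x‖ ^ 2 :=
  calc
    _ ≤ ‖inner ℂ x (V x)‖ := Complex.abs_re_le_norm _
    _ ≤ ‖x‖ * ‖V x‖ := norm_inner_le_norm _ _
    _ ≤ ‖x‖ * (‖V‖ * ‖x‖) := by gcongr; exact V.le_opNorm x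
    _ = _ := by ring

theorem continuous_quad (V : H →L[ℂ] H) : Continuous (quad V) :=
  Complex.continuous_re.comp (continuous_id.inner V.continuous)

/-- Uniform bounds on finite partial sums suffice to assemble a column operator. It serves both for
weak sums `∑ a_α X_α V X_α^*` and for the Berezin kernel. -/
theorem exists_lp_op {ι E : Type*} [NormedAddCommGroup E] [InnerProductSpace ℂ E]
    (L : ι → H →L[ℂ] E) (C : ℝ)
    (h : ∀ x (F : Finset ι), ∑ β ∈ F, ‖L β x‖ ^ 2 ≤ (C * ‖x‖) ^ 2) (hC : 0 ≤ C) :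
    ∃ K : H →L[ℂ] lp (fun _ : ι => E) 2, (∀ x β, K x β = L β x) ∧ ∀ x, ‖K x‖ ≤ C * ‖x‖ := by
  have hmem : ∀ x, Memℓp (fun β => L β x) 2 := fun x =>
    memℓp_gen' (C := (C * ‖x‖) ^ 2) fun s => by simpa using h x s
  have hb : ∀ x, ‖(⟨fun β => L β x, hmem x⟩ : lp (fun _ : ι => E) 2)‖ ≤ C * ‖x‖ := fun x =>
    lp.norm_le_of_forall_sum_le (by norm_num) (by positivity) fun s => by simpa using h x s
  refine ⟨LinearMap.mkContinuous
    { toFun := fun x => ⟨fun β => L β x, hmem x⟩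
      map_add' := fun x y => by ext β; exact map_add _ _ _
      map_smul' := fun c x => by ext β; exact map_smul _ _ _ } C hb, fun x β => rfl, hb⟩

theorem lp_two_hasSum_norm_sq {ι E : Type*} [NormedAddCommGroup E]
    (x : lp (fun _ : ι => E) 2) : HasSum (fun β => ‖x β‖ ^ 2) (‖x‖ ^ 2) := by
  simpa using lp.hasSum_norm (p := 2) (by norm_num) x

variable [CompleteSpace H]

theorem nonneg_iff_quad (V : H →L[ℂ] H) :
    0 ≤ V ↔ IsSelfAdjoint V ∧ ∀ x, 0 ≤ quad V x := by
  rw [nonneg_iff_isPositive, isPositive_def']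
  refine and_congr_right fun _ => forall_congr' fun x => ?_
  rw [reApplyInnerSelf, quad, ← inner_conj_symm, RCLike.conj_re]
  rfl

theorem quad_nonneg {V : H →L[ℂ] H} (hV : 0 ≤ V) (x : H) : 0 ≤ quad V x :=
  ((nonneg_iff_quad V).1 hV).2 x

theorem quad_mono {V U : H →L[ℂ] H} (h : V ≤ U) (x : H) : quad V x ≤ quad U x := by
  have := quad_nonneg (sub_nonneg.2 h) x
  rw [quad_sub] at this
  linarith

theorem le_of_quad_le {V U : H →L[ℂ] H} (hV : IsSelfAdjoint V) (hU : IsSelfAdjoint U)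
    (h : ∀ x, quad V x ≤ quad U x) : V ≤ U := by
  rw [← sub_nonneg, nonneg_iff_quad]
  exact ⟨hU.sub hV, fun x => by rw [quad_sub]; linarith [h x]⟩

end Forms

/-! ### The maps `Φ_{f,X}` for row contractions -/

section Phi

variable {H : Type u} [NormedAddCommGroup H] [InnerProductSpace ℂ H] {n : ℕ}

theorem wordOp_nil (X : Fin n → H →L[ℂ] H) : wordOp X [] = 1 := rfl

theorem wordOp_cons (X : Fin n → H →L[ℂ] H) (j : Fin n) (α : List (Fin n)) :
    wordOp X (j :: α) = X j * wordOp X α := by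
  simp [wordOp]

theorem wordOp_append (X : Fin n → H →L[ℂ] H) (α γ : List (Fin n)) :
    wordOp X (α ++ γ) = wordOp X α * wordOp X γ := by
  simp [wordOp]

variable [CompleteSpace H]

theorem adjoint_mul_apply (A B : H →L[ℂ] H) (x : H) :
    adjoint (A * B) x = adjoint B (adjoint A x) := by
  rw [show A * B = A ∘L B from rfl, adjoint_comp]
  rfl

theorem adjoint_wordOp_nil (X : Fin n → H →L[ℂ] H) (x : H) : adjoint (wordOp X []) x = x := by
  rw [wordOp_nil, ← star_eq_adjoint, star_one]
  rfl

theorem adjoint_wordOp_cons (X : Fin n → H →L[ℂ] H) (j : Fin n) (α : List (Fin n)) (x : H) :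
    adjoint (wordOp X (j :: α)) x = adjoint (wordOp X α) (adjoint (X j) x) := by
  rw [wordOp_cons, adjoint_mul_apply]

theorem adjoint_wordOp_append (X : Fin n → H →L[ℂ] H) (α γ : List (Fin n)) (x : H) :
    adjoint (wordOp X (α ++ γ)) x = adjoint (wordOp X γ) (adjoint (wordOp X α) x) := by
  rw [wordOp_append, adjoint_mul_apply]

/-- The condition `∑_α a_α X_α X_α^* ≤ I`, in terms of finite partial sums. -/
def RowContraction (f : PosRegular n) (X : Fin n → H →L[ℂ] H) : Prop :=
  ∀ (x : H) (F : Finset (List (Fin n))),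
    ∑ α ∈ F, f.coeff α * ‖adjoint (wordOp X α) x‖ ^ 2 ≤ ‖x‖ ^ 2

theorem inner_phiTerm (f : PosRegular n) (X : Fin n → H →L[ℂ] H) (V : H →L[ℂ] H)
    (α : List (Fin n)) (x y : H) : inner ℂ y (phiTerm f X V α x)
      = (f.coeff α : ℂ) * inner ℂ (adjoint (wordOp X α) y) (V (adjoint (wordOp X α) x)) := by
  rw [adjoint_inner_left, ← inner_smul_right]
  rfl

theorem hasSum_phiTerm_iff (f : PosRegular n) (X : Fin n → H →L[ℂ] H) (V Z : H →L[ℂ] H) :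
    HasSum (phiTerm f X V) (ContinuousLinearMapWOT.ofCLM Z) ↔
      ∀ x y, HasSum (fun α => (f.coeff α : ℂ) *
        inner ℂ (adjoint (wordOp X α) y) (V (adjoint (wordOp X α) x))) (inner ℂ y (Z x)) := by
  unfold HasSum
  rw [ContinuousLinearMapWOT.tendsto_iff_forall_inner_apply_tendsto]
  refine forall_congr' fun x => forall_congr' fun y => ?_
  have : ∀ F : Finset (List (Fin n)), inner ℂ y ((∑ α ∈ F, phiTerm f X V α) x)
      = ∑ α ∈ F, (f.coeff α : ℂ) *
        inner ℂ (adjoint (wordOp X α) y) (V (adjoint (wordOp X α) x)) := by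
    intro F
    induction F using Finset.cons_induction with
    | empty => simp
    | cons a s ha ih =>
      rw [Finset.sum_cons, Finset.sum_cons, ContinuousLinearMapWOT.add_apply, inner_add_right, ih,
        inner_phiTerm]
  simp only [this]
  rfl

/-- At `V = I` the diagonal matrix coefficients are sums of nonnegative terms, so each partial sum
is below the total. The finite form of the condition can later be checked on a dense set of vectors.
-/
theorem rowContraction_of_summable {f : PosRegular n} {X : Fin n → H →L[ℂ] H}
    (hs : Summable (phiTerm f X 1)) (hle : phi f X 1 ≤ 1) : RowContraction f X := by
  intro x F
  have h := (hasSum_phiTerm_iff f X 1 (phi f X 1)).1 hs.hasSum x x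
  have h2 : HasSum (fun α => f.coeff α * ‖adjoint (wordOp X α) x‖ ^ 2) (quad (phi f X 1) x) := by
    have h' := Complex.hasSum_re h
    refine h'.congr_fun ?_
    intro α
    change _ = ((f.coeff α : ℂ) * inner ℂ (adjoint (wordOp X α) x) (adjoint (wordOp X α) x)).re
    rw [inner_self_eq_norm_sq_to_K, Complex.re_ofReal_mul]
    norm_cast
  refine (sum_le_hasSum F (fun α _ => mul_nonneg (f.coeff_nonneg α) (by positivity)) h2).trans ?_
  rw [← quad_one]
  exact quad_mono hle x

namespace RowContraction

variable {f : PosRegular n} {X : Fin n → H →L[ℂ] H}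

/-- The sum factors as `C^* D`, where `C` and `D` are the bounded columns with entries `√a_α X_α^*`
and `√a_α V X_α^*`. Hence it converges weakly for every bounded `V`, positive or not. -/
theorem hasSum_phiTerm (h : RowContraction f X) (V : H →L[ℂ] H) :
    HasSum (phiTerm f X V) (ContinuousLinearMapWOT.ofCLM (phi f X V)) := by
  have hbound : ∀ U : H →L[ℂ] H, ∀ x (F : Finset (List (Fin n))),
      ∑ α ∈ F, ‖(((√(f.coeff α) : ℝ) : ℂ) • (U ∘L adjoint (wordOp X α))) x‖ ^ 2
        ≤ (‖U‖ * ‖x‖) ^ 2 := by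
    intro U x F
    rw [mul_pow]
    refine le_trans ?_ (mul_le_mul_of_nonneg_left (h x F) (sq_nonneg ‖U‖))
    rw [Finset.mul_sum]
    refine Finset.sum_le_sum fun α _ => ?_
    rw [smul_apply, norm_smul, mul_pow, Complex.norm_real, Real.norm_of_nonneg (Real.sqrt_nonneg _),
      Real.sq_sqrt (f.coeff_nonneg α), mul_left_comm, ← mul_pow]
    have := f.coeff_nonneg α
    gcongr
    exact U.le_opNorm _
  obtain ⟨C, hC, -⟩ := exists_lp_op _ _ (hbound 1) (norm_nonneg _)
  obtain ⟨D, hD, -⟩ := exists_lp_op _ _ (hbound V) (norm_nonneg _)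
  have hs : HasSum (phiTerm f X V) (ContinuousLinearMapWOT.ofCLM (adjoint C ∘L D)) := by
    refine (hasSum_phiTerm_iff f X V _).2 fun x y => ?_
    have := lp.hasSum_inner (𝕜 := ℂ) (C y) (D x)
    rw [comp_apply, adjoint_inner_right]
    refine this.congr_fun ?_
    intro α
    rw [hC, hD, smul_apply, smul_apply, inner_smul_left, inner_smul_right, Complex.conj_ofReal,
      ← mul_assoc, ← Complex.ofReal_mul, Real.mul_self_sqrt (f.coeff_nonneg α)]
    rfl
  unfold phi
  rw [hs.tsum_eq]
  exact hs

theorem hasSum_inner_phi (h : RowContraction f X) (V : H →L[ℂ] H) (x y : H) :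
    HasSum (fun α => (f.coeff α : ℂ) *
      inner ℂ (adjoint (wordOp X α) y) (V (adjoint (wordOp X α) x))) (inner ℂ y (phi f X V x)) :=
  (hasSum_phiTerm_iff f X V _).1 (h.hasSum_phiTerm V) x y

theorem hasSum_quad_phi (h : RowContraction f X) (V : H →L[ℂ] H) (x : H) :
    HasSum (fun α => f.coeff α * quad V (adjoint (wordOp X α) x)) (quad (phi f X V) x) := by
  refine (Complex.hasSum_re (h.hasSum_inner_phi V x x)).congr_fun ?_
  intro α
  rw [Complex.re_ofReal_mul]
  rfl

theorem inner_phi_adjoint (h : RowContraction f X) (V : H →L[ℂ] H) (x y : H) :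
    inner ℂ y (phi f X (adjoint V) x) = inner ℂ (phi f X V y) x := by
  have h1 := (Complex.hasSum_conj'.2 (h.hasSum_inner_phi V y x))
  rw [inner_conj_symm] at h1
  refine (h.hasSum_inner_phi (adjoint V) x y).unique (h1.congr_fun fun α => ?_)
  rw [map_mul, Complex.conj_ofReal, inner_conj_symm, adjoint_inner_right]

theorem phi_isSelfAdjoint (h : RowContraction f X) {V : H →L[ℂ] H} (hV : IsSelfAdjoint V) :
    IsSelfAdjoint (phi f X V) := by
  rw [isSelfAdjoint_iff']
  refine ContinuousLinearMap.ext fun x => ext_inner_left ℂ fun y => ?_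
  rw [adjoint_inner_right, ← h.inner_phi_adjoint, hV.adjoint_eq]

theorem phi_sub (h : RowContraction f X) (V U : H →L[ℂ] H) :
    phi f X (V - U) = phi f X V - phi f X U := by
  refine ContinuousLinearMap.ext fun x => ext_inner_left ℂ fun y => ?_
  refine (h.hasSum_inner_phi (V - U) x y).unique ?_
  rw [sub_apply, inner_sub_right]
  refine ((h.hasSum_inner_phi V x y).sub (h.hasSum_inner_phi U x y)).congr_fun fun α => ?_
  rw [sub_apply, inner_sub_right, mul_sub]

theorem phi_nonneg (h : RowContraction f X) {V : H →L[ℂ] H} (hV : 0 ≤ V) : 0 ≤ phi f X V := by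
  rw [nonneg_iff_quad] at hV ⊢
  exact ⟨h.phi_isSelfAdjoint hV.1, fun x => (h.hasSum_quad_phi V x).nonneg fun α =>
    mul_nonneg (f.coeff_nonneg α) (hV.2 _)⟩

theorem phi_mono (h : RowContraction f X) {V U : H →L[ℂ] H} (hVU : V ≤ U) :
    phi f X V ≤ phi f X U := by
  rw [← sub_nonneg, ← h.phi_sub]
  exact h.phi_nonneg (sub_nonneg.2 hVU)

theorem quad_phi_le (h : RowContraction f X) {V : H →L[ℂ] H} {c : ℝ} (hc : 0 ≤ c)
    (hV : ∀ x, quad V x ≤ c * ‖x‖ ^ 2) (x : H) : quad (phi f X V) x ≤ c * ‖x‖ ^ 2 := by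
  refine hasSum_le_of_sum_le (h.hasSum_quad_phi V x) fun F => ?_
  refine le_trans (Finset.sum_le_sum fun α _ =>
    mul_le_mul_of_nonneg_left (hV _) (f.coeff_nonneg α)) ?_
  refine le_trans (le_of_eq ?_) (mul_le_mul_of_nonneg_left (h x F) hc)
  rw [Finset.mul_sum]
  exact Finset.sum_congr rfl fun α _ => by ring

theorem phi_one_le (h : RowContraction f X) : phi f X 1 ≤ 1 :=
  le_of_quad_le (h.phi_isSelfAdjoint (IsSelfAdjoint.one _)) (IsSelfAdjoint.one _) fun x => by
    have := h.quad_phi_le (V := 1) zero_le_one (fun x => by rw [quad_one, one_mul]) x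
    rwa [quad_one, ← one_mul (‖x‖ ^ 2)]

/-- If `(id - Φ)² Z ≥ 0`, then `(id - Φ) Z ≥ 0`. -/
theorem sub_phi_nonneg (h : RowContraction f X) {Z : H →L[ℂ] H} (hZ : IsSelfAdjoint Z)
    (hD : 0 ≤ (Z - phi f X Z) - phi f X (Z - phi f X Z)) : 0 ≤ Z - phi f X Z := by
  set D := Z - phi f X Z with hDdef
  -- The hypothesis says `Φ D ≤ D`, and `Φ` is monotone.
  have hiter : ∀ q, (phi f X)^[q] D ≤ D := by
    intro q
    induction q with
    | zero => exact le_rfl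
    | succ q ih =>
      rw [Function.iterate_succ_apply']
      exact (h.phi_mono ih).trans (sub_nonneg.1 hD)
  have hsub : ∀ q, (phi f X)^[q] D = (phi f X)^[q] Z - (phi f X)^[q + 1] Z := by
    intro q
    induction q with
    | zero => rfl
    | succ q ih =>
      rw [Function.iterate_succ_apply', ih, h.phi_sub, ← Function.iterate_succ_apply' (phi f X) q,
        ← Function.iterate_succ_apply' (phi f X) (q + 1)]
  have hup : ∀ q x, quad ((phi f X)^[q] Z) x ≤ ‖Z‖ * ‖x‖ ^ 2 := by
    intro q
    induction q with
    | zero => exact fun x => (le_abs_self _).trans (abs_quad_le _ _)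
    | succ q ih =>
      rw [Function.iterate_succ_apply']
      exact h.quad_phi_le (norm_nonneg _) ih
  have hsum : ∀ (N : ℕ) x, quad Z x - quad ((phi f X)^[N] Z) x ≤ N * quad D x := by
    intro N x
    induction N with
    | zero => simp
    -- `Z - Φ^N Z` telescopes into `∑_{q < N} Φ^q D`, and each summand is at most `D`.
    | succ N ih =>
      have h1 := quad_mono (hiter N) x
      rw [hsub, quad_sub] at h1
      push_cast
      linarith
  rw [nonneg_iff_quad]
  refine ⟨hZ.sub (h.phi_isSelfAdjoint hZ), fun x => ?_⟩
  by_contra! hneg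
  -- The form of `Z - Φ^N Z` is at least `-2 ‖Z‖ ‖x‖²` for every `N`, but at most `N` times a
  -- negative number; this `N` makes the two bounds incompatible.
  obtain ⟨N, hN⟩ := exists_nat_gt (2 * (‖Z‖ * ‖x‖ ^ 2) / (-quad D x))
  rw [div_lt_iff₀ (by linarith)] at hN
  have h1 := hsum N x
  have h2 := hup N x
  have h3 := (abs_le.1 (abs_quad_le Z x)).1
  linarith

theorem iterate_isSelfAdjoint (h : RowContraction f X) {Z : H →L[ℂ] H} (hZ : IsSelfAdjoint Z)
    (p : ℕ) : IsSelfAdjoint ((fun V => V - phi f X V)^[p] Z) := by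
  induction p with
  | zero => exact hZ
  | succ p ih =>
    rw [Function.iterate_succ_apply']
    exact ih.sub (h.phi_isSelfAdjoint ih)

/-- Descending from `m`, each step applies `sub_phi_nonneg` to the next lower iterate. This reaches
only `p = 1`; positivity of `Z` itself does not follow and is assumed. -/
theorem iterate_nonneg (h : RowContraction f X) {Z : H →L[ℂ] H} (hZ : 0 ≤ Z) {m : ℕ}
    (hm : 0 ≤ (fun V => V - phi f X V)^[m] Z) {p : ℕ} (hp : p ≤ m) :
    0 ≤ (fun V => V - phi f X V)^[p] Z := by
  induction hp using Nat.decreasingInduction with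
  | self => exact hm
  | of_succ q hq ih =>
    rcases q with _ | q
    · exact hZ
    · rw [Function.iterate_succ_apply', Function.iterate_succ_apply'] at ih
      rw [Function.iterate_succ_apply']
      exact h.sub_phi_nonneg (h.iterate_isSelfAdjoint ((nonneg_iff_quad _).1 hZ).1 q) ih

end RowContraction

/-! ### Partial sums of `∑_α b_α X_α V X_α^*` -/

/-- Convolving `b^{(m+1)}` on the right with `1 - f` gives `b^{(m)}`. The cutoff `|αγ| ≤ N` keeps
the identity exact. It is applied with `g α` the value of a quadratic form at `X_α^* y`, where
`X_{αγ}^* = X_γ^* X_α^*`. -/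
theorem sum_invCoeff_succ (f : PosRegular n) (m N : ℕ) (g : List (Fin n) → ℝ) :
    ∑ α ∈ words n N, invCoeff f (m + 1) α *
        (g α - ∑ γ ∈ words n (N - α.length), f.coeff γ * g (α ++ γ))
      = ∑ α ∈ words n N, invCoeff f m α * g α := by
  have h := sum_words_splits N fun α γ => invCoeff f (m + 1) α * (f.coeff γ * g (α ++ γ))
  simp_rw [mul_sub, Finset.sum_sub_distrib, Finset.mul_sum]
  rw [← h, ← Finset.sum_sub_distrib]
  refine Finset.sum_congr rfl fun β _ => ?_
  rw [invCoeff_succ_right, add_mul, Finset.sum_mul, add_sub_assoc, ← Finset.sum_sub_distrib,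
    Finset.sum_eq_zero, add_zero]
  intro p hp
  rw [mem_splits] at hp
  rw [hp]
  ring

theorem sum_invCoeff_zero (f : PosRegular n) (N : ℕ) (g : List (Fin n) → ℝ) :
    ∑ α ∈ words n N, invCoeff f 0 α * g α = g [] := by
  rw [Finset.sum_eq_single_of_mem [] (mem_words.2 (Nat.zero_le _))]
  · simp [invCoeff_zero]
  · intro α _ hα
    simp [invCoeff_zero, hα]

/-- Telescoping in `m`: each exponent is lowered by `sum_invCoeff_succ`, and the tail of `Φ` that
the cutoff drops is nonnegative because the lower defects are. -/
theorem RowContraction.sum_invCoeff_le {f : PosRegular n} {X : Fin n → H →L[ℂ] H}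
    (h : RowContraction f X) (N : ℕ) (V : H →L[ℂ] H) (m : ℕ)
    (hV : ∀ p < m, 0 ≤ (fun V => V - phi f X V)^[p] V) (y : H) :
    ∑ α ∈ words n N, invCoeff f m α *
      quad ((fun V => V - phi f X V)^[m] V) (adjoint (wordOp X α) y) ≤ quad V y := by
  induction m with
  | zero =>
    rw [sum_invCoeff_zero f N fun α => quad _ (adjoint (wordOp X α) y), adjoint_wordOp_nil, Function.iterate_zero_apply]
  | succ m ih =>
    refine le_trans ?_ (ih fun p hp => hV p (hp.trans (Nat.lt_succ_self m)))
    rw [Function.iterate_succ_apply']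
    have hU := hV m (Nat.lt_succ_self m)
    set U := (fun V => V - phi f X V)^[m] V
    rw [← sum_invCoeff_succ f m N fun α => quad U (adjoint (wordOp X α) y)]
    refine Finset.sum_le_sum fun α _ => mul_le_mul_of_nonneg_left ?_ (invCoeff_nonneg _ _ _)
    rw [quad_sub]
    refine sub_le_sub_left ?_ _
    simp_rw [adjoint_wordOp_append]
    exact sum_le_hasSum _ (fun γ _ => mul_nonneg (f.coeff_nonneg γ) (quad_nonneg hU _))
      (h.hasSum_quad_phi U _)

/-- The same telescoping, but the dropped tail now vanishes on `y`. No positivity is needed. -/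
theorem RowContraction.sum_invCoeff_eq {f : PosRegular n} {X : Fin n → H →L[ℂ] H}
    (h : RowContraction f X) (N : ℕ) (V : H →L[ℂ] H) (m : ℕ) (y : H)
    (hy : ∀ α : List (Fin n), N < α.length → adjoint (wordOp X α) y = 0) :
    ∑ α ∈ words n N, invCoeff f m α *
      quad ((fun V => V - phi f X V)^[m] V) (adjoint (wordOp X α) y) = quad V y := by
  induction m with
  | zero =>
    rw [sum_invCoeff_zero f N fun α => quad _ (adjoint (wordOp X α) y), adjoint_wordOp_nil, Function.iterate_zero_apply]
  | succ m ih =>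
    refine Eq.trans ?_ ih
    rw [Function.iterate_succ_apply']
    set U := (fun V => V - phi f X V)^[m] V
    rw [← sum_invCoeff_succ f m N fun α => quad U (adjoint (wordOp X α) y)]
    refine Finset.sum_congr rfl fun α hα => ?_
    rw [quad_sub]
    congr 2
    simp_rw [adjoint_wordOp_append]
    refine (h.hasSum_quad_phi U _).unique (hasSum_sum_of_ne_finset_zero fun γ hγ => ?_)
    rw [← adjoint_wordOp_append, hy, quad_apply_zero, mul_zero]
    rw [mem_words] at hα hγ
    rw [List.length_append]
    omega

end Phi

/-! ### Several row contractions and the Berezin kernel -/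

section Box

variable {k : ℕ} {n : Fin k → ℕ}

/-- The tuples of words of length at most `N`, those outside `l` being empty. -/
noncomputable def box (n : Fin k → ℕ) (N : ℕ) (l : List (Fin k)) :
    Finset (∀ i, List (Fin (n i))) :=
  Fintype.piFinset fun i => if i ∈ l then words (n i) N else {[]}

theorem mem_box_finRange {N : ℕ} {β : ∀ i, List (Fin (n i))} :
    β ∈ box n N (List.finRange k) ↔ ∀ i, (β i).length ≤ N := by
  simp [box, mem_words]

theorem sum_box_nil (N : ℕ) (F : (∀ i, List (Fin (n i))) → ℝ) :
    ∑ β ∈ box n N [], F β = F fun _ => [] := by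
  have : box n N [] = {fun _ => []} := by
    ext β
    simp [box, funext_iff]
  rw [this, Finset.sum_singleton]

theorem sum_box_cons (N : ℕ) {i : Fin k} {l : List (Fin k)} (hi : i ∉ l)
    (F : (∀ i, List (Fin (n i))) → ℝ) :
    ∑ β ∈ box n N (i :: l), F β
      = ∑ β ∈ box n N l, ∑ α ∈ words (n i) N, F (Function.update β i α) := by
  rw [Finset.sum_sigma']
  refine Finset.sum_bij' (fun β _ => ⟨Function.update β i [], β i⟩)
    (fun x _ => Function.update x.1 i x.2) ?_ ?_ ?_ ?_ ?_
  · intro β hβ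
    simp only [box, Fintype.mem_piFinset, Finset.mem_sigma] at hβ ⊢
    refine ⟨fun l' => ?_, by simpa using hβ i⟩
    rcases eq_or_ne l' i with rfl | hl'
    · simp [hi]
    · simpa [Function.update_of_ne hl', hl'] using hβ l'
  · rintro ⟨β, α⟩ hx
    simp only [box, Fintype.mem_piFinset, Finset.mem_sigma] at hx ⊢
    intro l'
    rcases eq_or_ne l' i with rfl | hl'
    · simpa using hx.2
    · simpa [Function.update_of_ne hl', hl'] using hx.1 l'
  · intro β _
    simp
  · rintro ⟨β, α⟩ hx
    simp only [box, Fintype.mem_piFinset, Finset.mem_sigma] at hx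
    have h0 : β i = [] := by simpa [hi] using hx.1 i
    simp [← h0]
  · intro β _
    simp

end Box

section Kernel

variable {k : ℕ} {n : Fin k → ℕ} {H : Type u} [NormedAddCommGroup H] [InnerProductSpace ℂ H]
  [CompleteSpace H]

/-- The composition of the maps `(id - Φ_i)^{p_i}` over the indices `i` in a list. -/
noncomputable def defectFold (f : ∀ i, PosRegular (n i)) (X : ∀ i, Fin (n i) → H →L[ℂ] H)
    (p : Fin k → ℕ) (l : List (Fin k)) (Y : H →L[ℂ] H) : H →L[ℂ] H :=
  l.foldr (fun i Z => (fun V => V - phi (f i) (X i) V)^[p i] Z) Y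

theorem defectFold_cons (f : ∀ i, PosRegular (n i)) (X : ∀ i, Fin (n i) → H →L[ℂ] H)
    (p : Fin k → ℕ) (i : Fin k) (l : List (Fin k)) (Y : H →L[ℂ] H) :
    defectFold f X p (i :: l) Y
      = (fun V => V - phi (f i) (X i) V)^[p i] (defectFold f X p l Y) := rfl

theorem defectFold_append (f : ∀ i, PosRegular (n i)) (X : ∀ i, Fin (n i) → H →L[ℂ] H)
    (p : Fin k → ℕ) (l l' : List (Fin k)) (Y : H →L[ℂ] H) :
    defectFold f X p (l ++ l') Y = defectFold f X p l (defectFold f X p l' Y) :=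
  List.foldr_append

theorem defectFold_congr (f : ∀ i, PosRegular (n i)) (X : ∀ i, Fin (n i) → H →L[ℂ] H)
    {p q : Fin k → ℕ} {l : List (Fin k)} (h : ∀ i ∈ l, p i = q i) (Y : H →L[ℂ] H) :
    defectFold f X p l Y = defectFold f X q l Y := by
  induction l with
  | nil => rfl
  | cons i l ih =>
    rw [defectFold_cons, defectFold_cons, h i (by simp), ih fun i hi => h i (by simp [hi])]

theorem defectFold_zero (f : ∀ i, PosRegular (n i)) (X : ∀ i, Fin (n i) → H →L[ℂ] H)
    (l : List (Fin k)) (Y : H →L[ℂ] H) : defectFold f X (fun _ => 0) l Y = Y := by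
  induction l with
  | nil => rfl
  | cons i l ih => rw [defectFold_cons, ih, Function.iterate_zero_apply]

/-- Folding over a suffix means exponent zero at the other indices. Successive partial defects are
therefore exactly of the kind whose positivity defines the polydomain, and the maps `Φ_i` never have
to be interchanged. -/
theorem defectFold_suffix (f : ∀ i, PosRegular (n i)) (X : ∀ i, Fin (n i) → H →L[ℂ] H)
    (p : Fin k → ℕ) {l : List (Fin k)} (hl : l <:+ List.finRange k) (Y : H →L[ℂ] H) :
    defectFold f X p l Y = defectMap f X (fun i => if i ∈ l then p i else 0) Y := by
  obtain ⟨s, hs⟩ := hl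
  have hnd : (s ++ l).Nodup := hs ▸ List.nodup_finRange k
  have hdisj := List.disjoint_of_nodup_append hnd
  change _ = defectFold f X _ (List.finRange k) Y
  rw [← hs, defectFold_append, defectFold_congr f X (q := fun _ => 0) (l := s)
    (fun i hi => if_neg (hdisj hi)), defectFold_zero]
  exact defectFold_congr f X (fun i hi => (if_pos hi).symm) Y

/-- A relation between the summation over one index and the quadratic forms of the successive
defects gives the corresponding relation for the summation over all indices. It is an inequality
(`c = 1`) or the reverse inequality (`c = -1`). -/
theorem sum_box_quad (f : ∀ i, PosRegular (n i)) (m : Fin k → ℕ)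
    (X : ∀ i, Fin (n i) → H →L[ℂ] H) (N : ℕ) (c : ℝ) (V : H →L[ℂ] H) (P : Set H)
    (hP : ∀ y ∈ P, ∀ i α, adjoint (wordOp (X i) α) y ∈ P)
    (l : List (Fin k)) (hnd : l.Nodup)
    (hstep : ∀ i l', (i :: l') <:+ l → ∀ y ∈ P,
      c * ∑ α ∈ words (n i) N, invCoeff (f i) (m i) α *
        quad (defectFold f X m (i :: l') V) (adjoint (wordOp (X i) α) y)
        ≤ c * quad (defectFold f X m l' V) y) (y : H) (hy : y ∈ P) :
    c * ∑ β ∈ box n N l, (l.map fun i => invCoeff (f i) (m i) (β i)).prod *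
      quad (defectFold f X m l V) ((l.map fun i => adjoint (wordOp (X i) (β i))).prod y)
      ≤ c * quad V y := by
  induction l with
  | nil => rw [sum_box_nil]; simp [defectFold]
  | cons i l ih =>
    rw [List.nodup_cons] at hnd
    refine le_trans ?_ (ih hnd.2 fun i' l' hl' => hstep i' l' (hl'.trans (List.suffix_cons _ _)))
    -- The head index is outermost in the fold, and its words act last on the vector. So for fixed
    -- words at the remaining indices, the inner sum is an instance of `hstep` at a vector of `P`.
    rw [sum_box_cons N hnd.1, Finset.mul_sum, Finset.mul_sum]
    refine Finset.sum_le_sum fun β _ => ?_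
    have hmem : ∀ l' : List (Fin k),
        (l'.map fun i => adjoint (wordOp (X i) (β i))).prod y ∈ P := by
      intro l'
      induction l' with
      | nil => exact hy
      | cons i l' ih' => exact hP _ ih' i (β i)
    have h1 := hstep i l List.suffix_rfl _ (hmem l)
    have h2 : 0 ≤ (l.map fun i => invCoeff (f i) (m i) (β i)).prod := List.prod_nonneg (by
      intro a ha
      obtain ⟨i, -, rfl⟩ := List.mem_map.1 ha
      exact invCoeff_nonneg _ _ _)
    have h3 := mul_le_mul_of_nonneg_left h1 h2
    rw [mul_left_comm c]
    refine le_trans (le_of_eq ?_) h3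
    rw [mul_left_comm]
    congr 1
    rw [Finset.mul_sum]
    refine Finset.sum_congr rfl fun α _ => ?_
    have e1 : (l.map fun i' => invCoeff (f i') (m i') (Function.update β i α i'))
        = l.map fun i' => invCoeff (f i') (m i') (β i') :=
      List.map_congr_left fun i' hi' => by
        rw [Function.update_of_ne (ne_of_mem_of_not_mem hi' hnd.1)]
    have e2 : (l.map fun i' => adjoint (wordOp (X i') (Function.update β i α i')))
        = l.map fun i' => adjoint (wordOp (X i') (β i')) :=
      List.map_congr_left fun i' hi' => by
        rw [Function.update_of_ne (ne_of_mem_of_not_mem hi' hnd.1)]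
    rw [List.map_cons, List.map_cons, List.prod_cons, List.prod_cons, e1, e2,
      Function.update_self, mul_comm (invCoeff _ _ _), mul_assoc]
    rfl

theorem MemPolydomain.rowContraction {f : ∀ i, PosRegular (n i)} {m : Fin k → ℕ}
    {T : ∀ i, Fin (n i) → H →L[ℂ] H} (hT : MemPolydomain f m T) (i : Fin k) :
    RowContraction (f i) (T i) :=
  rowContraction_of_summable (hT.summable i) (hT.phi_le_one i)

theorem MemPolydomain.defectFold_nonneg {f : ∀ i, PosRegular (n i)} {m : Fin k → ℕ}
    {T : ∀ i, Fin (n i) → H →L[ℂ] H} (hT : MemPolydomain f m T) {l : List (Fin k)}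
    (hl : l <:+ List.finRange k) : 0 ≤ defectFold f T m l 1 := by
  rw [defectFold_suffix f T m hl]
  have h := hT.defect_nonneg fun i => if i ∈ l then 1 else 0
  have : (fun i => (((if i ∈ l then 1 else 0 : Fin 2) : Fin 2) : ℕ) * m i)
      = fun i => if i ∈ l then m i else 0 := by
    funext i
    split_ifs <;> simp
  rwa [this] at h

theorem MemPolydomain.defectMap_nonneg {f : ∀ i, PosRegular (n i)} {m : Fin k → ℕ}
    {T : ∀ i, Fin (n i) → H →L[ℂ] H} (hT : MemPolydomain f m T) : 0 ≤ defectMap f T m 1 :=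
  hT.defectFold_nonneg List.suffix_rfl

theorem MemPolydomain.sum_box_le {f : ∀ i, PosRegular (n i)} {m : Fin k → ℕ}
    {T : ∀ i, Fin (n i) → H →L[ℂ] H} (hT : MemPolydomain f m T) (N : ℕ) (y : H) :
    ∑ β ∈ box n N (List.finRange k), (∏ i, invCoeff (f i) (m i) (β i)) *
      quad (defectMap f T m 1)
        (((List.finRange k).map fun i => adjoint (wordOp (T i) (β i))).prod y) ≤ ‖y‖ ^ 2 := by
  have h := sum_box_quad f m T N 1 1 Set.univ (fun _ _ _ _ => Set.mem_univ _) (List.finRange k)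
    (List.nodup_finRange k) (fun i l hl y _ => by
      rw [one_mul, one_mul]
      refine (hT.rowContraction i).sum_invCoeff_le N _ (m i) (fun p hp => ?_) y
      -- The defects over `l` and over `i :: l` are positive by definition of the polydomain; those
      -- of intermediate order in `i` lie between them.
      exact (hT.rowContraction i).iterate_nonneg
        (hT.defectFold_nonneg ((List.suffix_cons _ _).trans hl)) (hT.defectFold_nonneg hl) hp.le)
    y (Set.mem_univ y)
  rw [one_mul, one_mul, quad_one] at h
  simp_rw [Fin.prod_univ_def]
  exact h

theorem adjoint_opSqrt (A : H →L[ℂ] H) : adjoint (opSqrt A) = opSqrt A :=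
  (CFC.sqrt_nonneg A).isSelfAdjoint.adjoint_eq

theorem opSqrt_opSqrt {A : H →L[ℂ] H} (hA : 0 ≤ A) (x : H) : opSqrt A (opSqrt A x) = A x :=
  congrArg (fun B : H →L[ℂ] H => B x) (CFC.sqrt_mul_sqrt_self A hA)

theorem norm_sqrtInto_sq {A : H →L[ℂ] H} (hA : 0 ≤ A) (x : H) :
    ‖sqrtInto A x‖ ^ 2 = quad A x := by
  change ‖opSqrt A x‖ ^ 2 = _
  rw [quad, ← opSqrt_opSqrt hA, ← adjoint_inner_left, adjoint_opSqrt, inner_self_eq_norm_sq_to_K]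
  norm_cast

/-- The operator `h ↦ √b_β Δ^{1/2} T_β^* h`. -/
noncomputable def kernelEntry (f : ∀ i, PosRegular (n i)) (m : Fin k → ℕ)
    (T : ∀ i, Fin (n i) → H →L[ℂ] H) (β : ∀ i, List (Fin (n i))) : H →L[ℂ] defectSpace f m T :=
  ((∏ i, √(bCoeff (f i) (m i) (β i)) : ℝ) : ℂ) • (sqrtInto (defectMap f T m 1) ∘L
    ((List.finRange k).map fun i => adjoint (wordOp (T i) (β i))).prod)

theorem norm_kernelEntry_sq {f : ∀ i, PosRegular (n i)} {m : Fin k → ℕ} (hm : ∀ i, 1 ≤ m i)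
    {T : ∀ i, Fin (n i) → H →L[ℂ] H} (hT : 0 ≤ defectMap f T m 1)
    (β : ∀ i, List (Fin (n i))) (h : H) :
    ‖kernelEntry f m T β h‖ ^ 2 = (∏ i, invCoeff (f i) (m i) (β i)) *
      quad (defectMap f T m 1)
        (((List.finRange k).map fun i => adjoint (wordOp (T i) (β i))).prod h) := by
  rw [kernelEntry, smul_apply, norm_smul, mul_pow, comp_apply, norm_sqrtInto_sq hT,
    Complex.norm_real, Real.norm_eq_abs, sq_abs, ← Finset.prod_pow]
  congr 1
  refine Finset.prod_congr rfl fun i _ => ?_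
  rw [bCoeff_eq_invCoeff _ (hm i), Real.sq_sqrt (invCoeff_nonneg _ _ _)]

theorem MemPolydomain.berezinKernel_spec {f : ∀ i, PosRegular (n i)} {m : Fin k → ℕ}
    (hm : ∀ i, 1 ≤ m i) {T : ∀ i, Fin (n i) → H →L[ℂ] H} (hT : MemPolydomain f m T) :
    IsBerezinKernel f m T (berezinKernel f m T) ∧ ∀ h, ‖berezinKernel f m T h‖ ≤ ‖h‖ := by
  have hb : ∀ (h : H) (F : Finset (∀ i, List (Fin (n i)))),
      ∑ β ∈ F, ‖kernelEntry f m T β h‖ ^ 2 ≤ (1 * ‖h‖) ^ 2 := by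
    intro h F
    -- Any finite set of tuples lies in the box given by its longest word.
    have hF : F ⊆ box n (F.sup fun β => Finset.univ.sup fun i => (β i).length)
        (List.finRange k) := by
      intro β hβ
      rw [mem_box_finRange]
      intro i
      exact (Finset.le_sup (f := fun i => (β i).length) (Finset.mem_univ i)).trans
        (Finset.le_sup (f := fun β : ∀ i, List (Fin (n i)) =>
          Finset.univ.sup fun i => (β i).length) hβ)
    refine (Finset.sum_le_sum_of_subset_of_nonneg hF fun β _ _ => sq_nonneg _).trans ?_
    simp_rw [norm_kernelEntry_sq hm hT.defectMap_nonneg, one_mul]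
    exact hT.sum_box_le _ h
  obtain ⟨K, hK, hKn⟩ := exists_lp_op _ 1 hb zero_le_one
  have hex : ∃ K, IsBerezinKernel f m T K := ⟨K, hK⟩
  have hspec : IsBerezinKernel f m T (berezinKernel f m T) := by
    unfold berezinKernel
    rw [dif_pos hex]
    exact hex.choose_spec
  refine ⟨hspec, fun h => ?_⟩
  have : berezinKernel f m T h = K h := by
    ext β : 2
    exact (hspec h β).trans (hK h β).symm
  rw [this, ← one_mul ‖h‖]
  exact hKn h

end Kernel

/-! ### Intertwining operators -/

section Intertwining

theorem op_mul_apply {H : Type*} [NormedAddCommGroup H] [InnerProductSpace ℂ H]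
    (A B : H →L[ℂ] H) (x : H) : (A * B) x = A (B x) := rfl

variable {H G : Type u} [NormedAddCommGroup H] [InnerProductSpace ℂ H] [CompleteSpace H]
  [NormedAddCommGroup G] [InnerProductSpace ℂ G] [CompleteSpace G]

theorem adjoint_intertwine {S : H →L[ℂ] G} {A : H →L[ℂ] H} {B : G →L[ℂ] G}
    (h : S ∘L A = B ∘L S) (y : G) : adjoint S (adjoint B y) = adjoint A (adjoint S y) := by
  rw [← comp_apply, ← adjoint_comp, ← h, adjoint_comp, comp_apply]

theorem adjoint_wordOp_intertwine {n : ℕ} {S : H →L[ℂ] G} {X : Fin n → H →L[ℂ] H}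
    {X' : Fin n → G →L[ℂ] G} (h : ∀ j, S ∘L X j = X' j ∘L S) (α : List (Fin n)) (y : G) :
    adjoint S (adjoint (wordOp X' α) y) = adjoint (wordOp X α) (adjoint S y) := by
  induction α generalizing y with
  | nil => rw [adjoint_wordOp_nil, adjoint_wordOp_nil]
  | cons j α ih => rw [adjoint_wordOp_cons, adjoint_wordOp_cons, ih, adjoint_intertwine (h j)]

/-- Termwise, `X'_α S V S^* X'_α^* = S X_α V X_α^* S^*`. It is used with `S` a multi-analytic
operator between universal models, and with `S = R^*` from a compression to the universal model. -/
theorem phi_intertwine {n : ℕ} {f : PosRegular n} {S : H →L[ℂ] G} {X : Fin n → H →L[ℂ] H}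
    {X' : Fin n → G →L[ℂ] G} (h : ∀ j, S ∘L X j = X' j ∘L S) (hX : RowContraction f X)
    (hX' : RowContraction f X') (V : H →L[ℂ] H) :
    phi f X' (S ∘L V ∘L adjoint S) = S ∘L phi f X V ∘L adjoint S := by
  refine ContinuousLinearMap.ext fun x => ext_inner_left ℂ fun y => ?_
  refine (hX'.hasSum_inner_phi _ x y).unique ?_
  rw [comp_apply, comp_apply, ← adjoint_inner_left]
  refine (hX.hasSum_inner_phi V (adjoint S x) (adjoint S y)).congr_fun fun α => ?_
  rw [comp_apply, comp_apply, ← adjoint_inner_left, adjoint_wordOp_intertwine h,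
    adjoint_wordOp_intertwine h]

theorem defectFold_intertwine {k : ℕ} {n : Fin k → ℕ} {f : ∀ i, PosRegular (n i)} {S : H →L[ℂ] G}
    {X : ∀ i, Fin (n i) → H →L[ℂ] H} {X' : ∀ i, Fin (n i) → G →L[ℂ] G}
    (h : ∀ i j, S ∘L X i j = X' i j ∘L S) (hX : ∀ i, RowContraction (f i) (X i))
    (hX' : ∀ i, RowContraction (f i) (X' i)) (p : Fin k → ℕ) (l : List (Fin k)) (V : H →L[ℂ] H) :
    defectFold f X' p l (S ∘L V ∘L adjoint S) = S ∘L defectFold f X p l V ∘L adjoint S := by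
  induction l with
  | nil => rfl
  | cons i l ih =>
    rw [defectFold_cons, defectFold_cons, ih]
    generalize p i = q
    induction q with
    | zero => rfl
    | succ q ihq =>
      rw [Function.iterate_succ_apply', Function.iterate_succ_apply', ihq,
        phi_intertwine (h i) (hX i) (hX' i), sub_comp, comp_sub]

theorem prod_adjoint_wordOp_intertwine {k : ℕ} {n : Fin k → ℕ} {S : H →L[ℂ] G}
    {X : ∀ i, Fin (n i) → H →L[ℂ] H} {X' : ∀ i, Fin (n i) → G →L[ℂ] G}
    (h : ∀ i j, S ∘L X i j = X' i j ∘L S) (β : ∀ i, List (Fin (n i))) (l : List (Fin k)) (y : G) :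
    adjoint S ((l.map fun i => adjoint (wordOp (X' i) (β i))).prod y)
      = (l.map fun i => adjoint (wordOp (X i) (β i))).prod (adjoint S y) := by
  induction l with
  | nil => rfl
  | cons i l ih =>
    rw [List.map_cons, List.map_cons, List.prod_cons, List.prod_cons, op_mul_apply,
      op_mul_apply, adjoint_wordOp_intertwine (h i), ih]

theorem defectFold_isSelfAdjoint {k : ℕ} {n : Fin k → ℕ} {f : ∀ i, PosRegular (n i)}
    {X : ∀ i, Fin (n i) → H →L[ℂ] H} (hX : ∀ i, RowContraction (f i) (X i)) (p : Fin k → ℕ)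
    (l : List (Fin k)) {V : H →L[ℂ] H} (hV : IsSelfAdjoint V) :
    IsSelfAdjoint (defectFold f X p l V) := by
  induction l with
  | nil => exact hV
  | cons i l ih => exact (hX i).iterate_isSelfAdjoint ih _

theorem conj_nonneg (S : H →L[ℂ] G) {V : H →L[ℂ] H} (hV : 0 ≤ V) :
    0 ≤ S ∘L V ∘L adjoint S := by
  rw [nonneg_iff_isPositive] at hV ⊢
  exact hV.conj_adjoint S

end Intertwining

/-! ### The universal model -/

section Universal

variable {k : ℕ} {n : Fin k → ℕ} {E : Type u} [NormedAddCommGroup E] [InnerProductSpace ℂ E]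

theorem update_append_injective (i : Fin k) (α : List (Fin (n i))) :
    Function.Injective
      (fun β : (∀ i, List (Fin (n i))) => Function.update β i (α ++ β i)) := by
  intro β γ h
  funext l
  have hl := congrFun h l
  by_cases hli : l = i
  · subst hli
    simpa using hl
  · simpa [Function.update_of_ne hli] using hl

theorem invCoeff_pos {n : ℕ} (f : PosRegular n) {m : ℕ} (hm : 1 ≤ m) (α : List (Fin n)) :
    0 < invCoeff f m α :=
  bCoeff_eq_invCoeff f hm α ▸ bCoeff_pos f m α

/-- By the left recursion, `∑ a_α b_δ` over `αδ = β` equals `b^{(m)}_β - b^{(m-1)}_β`, and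
`b^{(m-1)}` is nonnegative. -/
theorem sum_splits_div_le {n : ℕ} (f : PosRegular n) {m : ℕ} (hm : 1 ≤ m) (β : List (Fin n)) :
    ∑ p ∈ splits β, f.coeff p.1 * (invCoeff f m p.2 / invCoeff f m β) ≤ 1 := by
  obtain ⟨m, rfl⟩ := Nat.exists_eq_add_of_le' hm
  simp_rw [← mul_div_assoc]
  rw [← Finset.sum_div, div_le_one (invCoeff_pos f hm β)]
  have h := invCoeff_succ_left f m β
  have h0 := invCoeff_nonneg f m β
  linarith

theorem inner_apply_eq (β : ∀ i, List (Fin (n i))) (y : E) (x : FockTensor n E) :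
    inner ℂ y (x β) = inner ℂ (lp.single 2 β y : FockTensor n E) x := by
  rw [lp.inner_single_left]

/-- The vectors whose coordinates vanish at all tuples with a word of length greater than `N`. -/
def truncated (n : Fin k → ℕ) (E : Type u) [NormedAddCommGroup E] [InnerProductSpace ℂ E]
    (N : ℕ) : Set (FockTensor n E) :=
  {x | ∀ β : (∀ i, List (Fin (n i))), (∃ i, N < (β i).length) → x β = 0}

theorem dense_truncated : Dense {x : FockTensor n E | ∃ N, x ∈ truncated n E N} := by
  intro x
  refine mem_closure_of_tendsto (lp.hasSum_single (by norm_num) x) (Eventually.of_forall fun F => ?_)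
  refine ⟨F.sup fun β => Finset.univ.sup fun i => (β i).length, ?_⟩
  rintro β ⟨i, hi⟩
  rw [lp.coeFn_sum, Finset.sum_apply]
  refine Finset.sum_eq_zero fun γ hγ => ?_
  rw [lp.coeFn_single, Pi.single_eq_of_ne]
  rintro rfl
  exact absurd hi (not_lt.2 ((Finset.le_sup (f := fun i => (β i).length) (Finset.mem_univ i)).trans
    (Finset.le_sup (f := fun β : ∀ i, List (Fin (n i)) =>
      Finset.univ.sup fun i => (β i).length) hγ)))

variable [CompleteSpace E]

theorem adjoint_universalModel_apply (f : ∀ i, PosRegular (n i)) (m : Fin k → ℕ) (i : Fin k)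
    (j : Fin (n i)) (x : FockTensor n E) (γ : ∀ i, List (Fin (n i))) :
    adjoint (universalModel f m E i j) x γ
      = (weight (f i) (m i) j (γ i) : ℂ) • x (Function.update γ i (j :: γ i)) := by
  rw [universalModel, adjoint_adjoint]
  rfl

theorem universalModel_commute (f : ∀ i, PosRegular (n i)) (m : Fin k → ℕ) {i i' : Fin k}
    (hi : i ≠ i') (j : Fin (n i)) (j' : Fin (n i')) (x : FockTensor n E) :
    adjoint (universalModel f m E i j) (adjoint (universalModel f m E i' j') x)
      = adjoint (universalModel f m E i' j') (adjoint (universalModel f m E i j) x) := by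
  ext γ : 2
  simp only [adjoint_universalModel_apply, Function.update_of_ne hi, Function.update_of_ne hi.symm]
  rw [smul_comm]
  have h := Function.update_comm hi (j :: γ i) (j' :: γ i') γ
  rw [h]

theorem adjoint_wordOp_universalModel_apply {f : ∀ i, PosRegular (n i)} {m : Fin k → ℕ} (i : Fin k)
    (α : List (Fin (n i))) (x : FockTensor n E) (γ : ∀ i, List (Fin (n i))) :
    adjoint (wordOp (universalModel f m E i) α) x γ
      = ((√(bCoeff (f i) (m i) (γ i)) / √(bCoeff (f i) (m i) (α ++ γ i)) : ℝ) : ℂ)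
        • x (Function.update γ i (α ++ γ i)) := by
  induction α generalizing x with
  | nil =>
    rw [adjoint_wordOp_nil, List.nil_append, Function.update_eq_self,
      div_self (Real.sqrt_pos.2 (bCoeff_pos _ _ _)).ne', Complex.ofReal_one, one_smul]
  | cons j α ih =>
    rw [adjoint_wordOp_cons, ih, adjoint_universalModel_apply, smul_smul, ← Complex.ofReal_mul,
      Function.update_self, Function.update_idem, weight, List.cons_append,
      div_mul_div_cancel₀ (Real.sqrt_pos.2 (bCoeff_pos _ _ _)).ne']

theorem adjoint_wordOp_universalModel_single {f : ∀ i, PosRegular (n i)} {m : Fin k → ℕ}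
    (i : Fin k) {α δ : List (Fin (n i))} {β : ∀ i, List (Fin (n i))} (h : α ++ δ = β i) (y : E) :
    adjoint (wordOp (universalModel f m E i) α) (lp.single 2 β y)
      = ((√(bCoeff (f i) (m i) δ) / √(bCoeff (f i) (m i) (β i)) : ℝ) : ℂ)
        • lp.single 2 (Function.update β i δ) y := by
  ext γ : 2
  rw [adjoint_wordOp_universalModel_apply, lp.coeFn_smul, Pi.smul_apply, lp.coeFn_single,
    lp.coeFn_single]
  by_cases hγ : γ = Function.update β i δ
  · subst hγ
    simp [h]
  · have : Function.update γ i (α ++ γ i) ≠ β := by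
      rintro rfl
      refine hγ ?_
      rw [Function.update_self] at h
      rw [List.append_cancel_left h]
      simp
    rw [Pi.single_eq_of_ne this, Pi.single_eq_of_ne hγ, smul_zero, smul_zero]

theorem adjoint_wordOp_universalModel_single_eq_zero {f : ∀ i, PosRegular (n i)} {m : Fin k → ℕ}
    (i : Fin k) {α : List (Fin (n i))} {β : ∀ i, List (Fin (n i))} (h : ∀ δ, α ++ δ ≠ β i) (y : E) :
    adjoint (wordOp (universalModel f m E i) α) (lp.single 2 β y) = 0 := by
  ext γ : 2
  have : Function.update γ i (α ++ γ i) ≠ β := by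
    rintro rfl
    exact h (γ i) (by simp)
  rw [adjoint_wordOp_universalModel_apply, lp.coeFn_single, Pi.single_eq_of_ne this, smul_zero]
  rfl

/-- Collecting `∑_α a_α ‖W_α^* x‖²` by the coordinates of `x` leaves the factor `∑ a_α b_δ /
b_{β_i}` over `αδ = β_i` in front of `‖x_β‖²`. -/
theorem universalModel_rowContraction (f : ∀ i, PosRegular (n i)) {m : Fin k → ℕ}
    (hm : ∀ i, 1 ≤ m i) (i : Fin k) : RowContraction (f i) (universalModel f m E i) := by
  intro x F
  -- `c α β` is the squared weight with which `W_α^*` strips the prefix `α` from `β_i`. At most one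
  -- splitting has first word `α`; without one, the value is `0`.
  set c : List (Fin (n i)) → (∀ i, List (Fin (n i))) → ℝ := fun α β =>
    ∑ p ∈ splits (β i), if p.1 = α then
      invCoeff (f i) (m i) p.2 / invCoeff (f i) (m i) (β i) else 0 with hc
  have hnorm : ∀ α, HasSum (fun β => c α β * ‖x β‖ ^ 2)
      (‖adjoint (wordOp (universalModel f m E i) α) x‖ ^ 2) := by
    intro α
    rw [← (update_append_injective i α).hasSum_iff]
    · refine (lp_two_hasSum_norm_sq _).congr_fun fun γ => ?_
      have h1 : (α, γ i) ∈ splits (α ++ γ i) := mem_splits.2 rfl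
      rw [adjoint_wordOp_universalModel_apply, norm_smul, mul_pow, Complex.norm_real,
        Real.norm_of_nonneg (by positivity), div_pow, Real.sq_sqrt (bCoeff_pos _ _ _).le,
        Real.sq_sqrt (bCoeff_pos _ _ _).le, bCoeff_eq_invCoeff _ (hm i),
        bCoeff_eq_invCoeff _ (hm i), Function.comp_apply, hc]
      simp only [Function.update_self]
      rw [Finset.sum_eq_single_of_mem _ h1, if_pos rfl]
      intro p hp hne
      refine if_neg fun h => hne ?_
      exact splits_fst_injOn _ hp h1 h
    · intro β hβ
      have : c α β = 0 := Finset.sum_eq_zero fun p hp => if_neg fun h => hβ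
        ⟨Function.update β i p.2, by simp [← h, mem_splits.1 hp]⟩
      rw [this, zero_mul]
  refine hasSum_le (fun β => ?_) (hasSum_sum fun α (_ : α ∈ F) =>
    (hnorm α).mul_left ((f i).coeff α)) (lp_two_hasSum_norm_sq x)
  simp_rw [← mul_assoc]
  rw [← Finset.sum_mul]
  refine mul_le_of_le_one_left (sq_nonneg _) (le_trans ?_ (sum_splits_div_le (f i) (hm i) (β i)))
  simp_rw [hc, Finset.mul_sum]
  rw [Finset.sum_comm]
  refine Finset.sum_le_sum fun p _ => ?_
  simp_rw [mul_ite, mul_zero]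
  rw [Finset.sum_ite_eq]
  split_ifs
  · exact le_rfl
  · exact mul_nonneg ((f i).coeff_nonneg _)
      (div_nonneg (invCoeff_nonneg _ _ _) (invCoeff_nonneg _ _ _))

/-- `V` acts as multiplication by the real family `d` on the coordinates. -/
def IsDiagonal (V : FockTensor n E →L[ℂ] FockTensor n E)
    (d : (∀ i, List (Fin (n i))) → ℝ) : Prop :=
  ∀ x β, V x β = (d β : ℂ) • x β

theorem IsDiagonal.nonneg {V : FockTensor n E →L[ℂ] FockTensor n E}
    {d : (∀ i, List (Fin (n i))) → ℝ} (hV : IsDiagonal V d) (hd : ∀ β, 0 ≤ d β) : 0 ≤ V := by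
  rw [nonneg_iff_quad]
  constructor
  · rw [isSelfAdjoint_iff']
    refine ContinuousLinearMap.ext fun x => ext_inner_left ℂ fun y => ?_
    rw [adjoint_inner_right]
    refine (lp.hasSum_inner (V y) x).unique ((lp.hasSum_inner y (V x)).congr_fun fun β => ?_)
    rw [hV, hV, inner_smul_left, inner_smul_right, Complex.conj_ofReal]
  · intro x
    refine (Complex.hasSum_re (lp.hasSum_inner (𝕜 := ℂ) x (V x))).nonneg fun β => ?_
    rw [hV, inner_smul_right, Complex.re_ofReal_mul]
    exact mul_nonneg (hd β) (inner_self_nonneg (𝕜 := ℂ))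

theorem IsDiagonal.phi {f : ∀ i, PosRegular (n i)} {m : Fin k → ℕ} (hm : ∀ i, 1 ≤ m i)
    {V : FockTensor n E →L[ℂ] FockTensor n E} {d : (∀ i, List (Fin (n i))) → ℝ}
    (hV : IsDiagonal V d) (i : Fin k) :
    IsDiagonal (phi (f i) (universalModel f m E i) V) fun β => ∑ p ∈ splits (β i),
      (f i).coeff p.1 * (invCoeff (f i) (m i) p.2 / invCoeff (f i) (m i) (β i) *
        d (Function.update β i p.2)) := by
  intro x β
  refine ext_inner_left ℂ fun y : E => (inner_apply_eq β y _).trans ?_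
  refine ((universalModel_rowContraction f hm i).hasSum_inner_phi V x _).unique ?_
  -- Only prefixes of `β_i` contribute, so at a fixed coordinate the weak sum is finite.
  have hz : ∀ α ∉ (splits (β i)).image Prod.fst, (((f i).coeff α : ℝ) : ℂ) *
      inner ℂ (adjoint (wordOp (universalModel f m E i) α) (lp.single 2 β y))
        (V (adjoint (wordOp (universalModel f m E i) α) x)) = 0 := by
    intro α hα
    rw [adjoint_wordOp_universalModel_single_eq_zero, inner_zero_left, mul_zero]
    exact fun δ hδ => hα (Finset.mem_image.2 ⟨(α, δ), mem_splits.2 hδ, rfl⟩)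
  suffices key : ∑ α ∈ (splits (β i)).image Prod.fst, (((f i).coeff α : ℝ) : ℂ) *
      inner ℂ (adjoint (wordOp (universalModel f m E i) α) (lp.single 2 β y))
        (V (adjoint (wordOp (universalModel f m E i) α) x)) = inner ℂ y (((∑ p ∈ splits (β i),
          (f i).coeff p.1 * (invCoeff (f i) (m i) p.2 / invCoeff (f i) (m i) (β i) *
            d (Function.update β i p.2)) : ℝ) : ℂ) • x β) from
    key ▸ hasSum_sum_of_ne_finset_zero hz
  rw [Finset.sum_image (splits_fst_injOn _), inner_smul_right, Complex.ofReal_sum, Finset.sum_mul]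
  refine Finset.sum_congr rfl fun p hp => ?_
  rw [mem_splits] at hp
  rw [adjoint_wordOp_universalModel_single i hp, inner_smul_left, lp.inner_single_left, hV,
    adjoint_wordOp_universalModel_apply, Function.update_self, Function.update_idem, hp,
    Function.update_eq_self, inner_smul_right, inner_smul_right, Complex.conj_ofReal,
    Complex.ofReal_mul, Complex.ofReal_mul, mul_assoc, mul_assoc]
  congr 1
  have hr : invCoeff (f i) (m i) p.2 / invCoeff (f i) (m i) (β i)
      = √(bCoeff (f i) (m i) p.2) / √(bCoeff (f i) (m i) (β i)) *
        (√(bCoeff (f i) (m i) p.2) / √(bCoeff (f i) (m i) (β i))) := by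
    rw [div_mul_div_comm, Real.mul_self_sqrt (bCoeff_pos _ _ _).le,
      Real.mul_self_sqrt (bCoeff_pos _ _ _).le, bCoeff_eq_invCoeff _ (hm i),
      bCoeff_eq_invCoeff _ (hm i)]
  rw [hr, Complex.ofReal_mul]
  ring

/-- The left recursion for `b^{(m-p)}` shows that one more factor `id - Φ` lowers the numerator to
`b^{(m-p-1)}`: the factors `b^{(m)}_δ` cancel. This needs `d` to be independent of the `i`-th word.
-/
theorem IsDiagonal.iterate {f : ∀ i, PosRegular (n i)} {m : Fin k → ℕ} (hm : ∀ i, 1 ≤ m i)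
    {V : FockTensor n E →L[ℂ] FockTensor n E} {d : (∀ i, List (Fin (n i))) → ℝ}
    (hV : IsDiagonal V d) (i : Fin k) (hd : ∀ β δ, d (Function.update β i δ) = d β) {p : ℕ}
    (hp : p ≤ m i) :
    IsDiagonal ((fun V => V - NCPolydomain.phi (f i) (universalModel f m E i) V)^[p] V) fun β =>
      invCoeff (f i) (m i - p) (β i) / invCoeff (f i) (m i) (β i) * d β := by
  induction p with
  | zero =>
    intro x β
    change V x β = ((invCoeff (f i) (m i - 0) (β i) / invCoeff (f i) (m i) (β i) * d β : ℝ) : ℂ) • x β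
    rw [Nat.sub_zero, div_self (invCoeff_pos _ (hm i) _).ne', one_mul]
    exact hV x β
  | succ p ih =>
    intro x β
    have ih' := ih (by omega)
    rw [Function.iterate_succ_apply']
    refine (congrArg₂ (· - ·) (ih' x β) (ih'.phi hm i x β)).trans
      ((sub_smul _ _ _).symm.trans (congrArg (· • x β) ?_))
    rw [← Complex.ofReal_sub]
    congr 1
    beta_reduce
    have hpos := (invCoeff_pos (f i) (hm i) (β i)).ne'
    have hrec := invCoeff_succ_left (f i) (m i - (p + 1)) (β i)
    rw [show m i - (p + 1) + 1 = m i - p by omega] at hrec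
    rw [hrec, add_div, add_mul, add_sub_assoc, Finset.sum_div, Finset.sum_mul,
      ← Finset.sum_sub_distrib, Finset.sum_eq_zero, add_zero]
    intro q _
    have hpos' := (invCoeff_pos (f i) (hm i) q.2).ne'
    rw [Function.update_self, hd]
    field_simp
    ring

theorem universalModel_defectFold_isDiagonal (f : ∀ i, PosRegular (n i)) {m : Fin k → ℕ}
    (hm : ∀ i, 1 ≤ m i) {p : Fin k → ℕ} (hp : p ≤ m) (l : List (Fin k)) (hl : l.Nodup) :
    IsDiagonal (defectFold f (universalModel f m E) p l 1) fun β =>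
      (l.map fun i => invCoeff (f i) (m i - p i) (β i) / invCoeff (f i) (m i) (β i)).prod := by
  induction l with
  | nil =>
    intro x β
    simp only [List.map_nil, List.prod_nil, Complex.ofReal_one, one_smul]
    rfl
  | cons i l ih =>
    rw [List.nodup_cons] at hl
    refine (ih hl.2).iterate hm i (fun β δ => ?_) (hp i)
    congr 1
    refine List.map_congr_left fun i' hi' => ?_
    rw [Function.update_of_ne (ne_of_mem_of_not_mem hi' hl.1)]

theorem universalModel_defectMap_nonneg (f : ∀ i, PosRegular (n i)) {m : Fin k → ℕ}
    (hm : ∀ i, 1 ≤ m i) {p : Fin k → ℕ} (hp : p ≤ m) :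
    0 ≤ defectMap f (universalModel f m E) p 1 := by
  refine (universalModel_defectFold_isDiagonal f hm hp _ (List.nodup_finRange k)).nonneg
    fun β => List.prod_nonneg ?_
  intro a ha
  obtain ⟨i, -, rfl⟩ := List.mem_map.1 ha
  exact div_nonneg (invCoeff_nonneg _ _ _) (invCoeff_nonneg _ _ _)

theorem adjoint_wordOp_mem_truncated {f : ∀ i, PosRegular (n i)} {m : Fin k → ℕ} {N : ℕ}
    {x : FockTensor n E} (hx : x ∈ truncated n E N) (i : Fin k) (α : List (Fin (n i))) :
    adjoint (wordOp (universalModel f m E i) α) x ∈ truncated n E N := by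
  rintro β ⟨l, hl⟩
  rw [adjoint_wordOp_universalModel_apply, hx, smul_zero]
  refine ⟨l, ?_⟩
  rcases eq_or_ne l i with rfl | h
  · rw [Function.update_self, List.length_append]
    omega
  · rwa [Function.update_of_ne h]

theorem adjoint_wordOp_eq_zero_of_mem_truncated {f : ∀ i, PosRegular (n i)} {m : Fin k → ℕ}
    {N : ℕ} {x : FockTensor n E} (hx : x ∈ truncated n E N) (i : Fin k) {α : List (Fin (n i))}
    (hα : N < α.length) : adjoint (wordOp (universalModel f m E i) α) x = 0 := by
  ext β : 2
  rw [adjoint_wordOp_universalModel_apply, hx, smul_zero]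
  · rfl
  · exact ⟨i, by rw [Function.update_self, List.length_append]; omega⟩

end Universal

/-! ### Properties of the Berezin kernel -/

section Kernel

variable {k : ℕ} {n : Fin k → ℕ} {H : Type u} [NormedAddCommGroup H] [InnerProductSpace ℂ H]

theorem wordOp_commute {a b : ℕ} {X : Fin a → H →L[ℂ] H} {Z : Fin b → H →L[ℂ] H}
    (h : ∀ j j', Commute (X j) (Z j')) (j : Fin a) (α : List (Fin b)) :
    Commute (X j) (wordOp Z α) :=
  Commute.list_prod_right _ _ fun A hA => by
    obtain ⟨j', -, rfl⟩ := List.mem_map.1 hA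
    exact h j j'

variable [CompleteSpace H]

/-- The new letter is the first of its word, so its adjoint acts before the rest of that word; it
then moves past the words of the other indices, with which it commutes. The case distinction carries
the induction through lists that do not contain `i`. -/
theorem prod_adjoint_wordOp_update {T : ∀ i, Fin (n i) → H →L[ℂ] H}
    (hT : ∀ i i', i ≠ i' → ∀ j j', Commute (T i j) (T i' j')) (β : ∀ i, List (Fin (n i)))
    (i : Fin k) (j : Fin (n i)) (l : List (Fin k)) (hl : l.Nodup) (h : H) :
    (l.map fun i' => adjoint (wordOp (T i') (Function.update β i (j :: β i) i'))).prod h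
      = (l.map fun i' => adjoint (wordOp (T i') (β i'))).prod
          (if i ∈ l then adjoint (T i j) h else h) := by
  induction l with
  | nil => rfl
  | cons i' l ih =>
    rw [List.nodup_cons] at hl
    rw [List.map_cons, List.map_cons, List.prod_cons, List.prod_cons, op_mul_apply,
      op_mul_apply, ih hl.2]
    rcases eq_or_ne i' i with rfl | hi
    · rw [if_neg hl.1, if_pos List.mem_cons_self, Function.update_self, adjoint_wordOp_cons]
      congr 1
      have hcomm : ∀ l' : List (Fin k), i' ∉ l' →
          Commute (adjoint (T i' j)) (l'.map fun i => adjoint (wordOp (T i) (β i))).prod := by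
        intro l' hl'
        refine Commute.list_prod_right _ _ fun A hA => ?_
        obtain ⟨i, hi, rfl⟩ := List.mem_map.1 hA
        exact (wordOp_commute (hT i' i (ne_of_mem_of_not_mem hi hl').symm) j (β i)).star_star
      exact congrArg (fun B : H →L[ℂ] H => B h) (hcomm l hl.1).eq
    · rw [Function.update_of_ne hi]
      simp [hi.symm]

/-- The weight of the backward shift turns `√b_{g_j β_i}` into `√b_{β_i}`, and the extra letter
becomes `T_{i,j}^*` acting on `h`. -/
theorem berezinKernel_intertwine {f : ∀ i, PosRegular (n i)} {m : Fin k → ℕ}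
    (hm : ∀ i, 1 ≤ m i) {T : ∀ i, Fin (n i) → H →L[ℂ] H} (hT : MemPolydomain f m T) (i : Fin k)
    (j : Fin (n i)) :
    berezinKernel f m T ∘L adjoint (T i j)
      = adjoint (universalModel f m (defectSpace f m T) i j) ∘L berezinKernel f m T := by
  have hK := (hT.berezinKernel_spec hm).1
  ext h β : 3
  rw [comp_apply, comp_apply, adjoint_universalModel_apply, hK, hK,
    prod_adjoint_wordOp_update hT.commute β i j _ (List.nodup_finRange k),
    if_pos (List.mem_finRange i), smul_smul, ← Complex.ofReal_mul]
  congr 2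
  have h1 : ∀ i' ∈ Finset.univ.erase i, √(bCoeff (f i') (m i') (Function.update β i (j :: β i) i'))
      = √(bCoeff (f i') (m i') (β i')) := fun i' hi' => by
    rw [Function.update_of_ne (Finset.ne_of_mem_erase hi')]
  rw [← Finset.mul_prod_erase _ _ (Finset.mem_univ i), ← Finset.mul_prod_erase _ (fun i' =>
    √(bCoeff (f i') (m i') (Function.update β i (j :: β i) i'))) (Finset.mem_univ i),
    Finset.prod_congr rfl h1, Function.update_self, weight, ← mul_assoc,
    div_mul_cancel₀ _ (Real.sqrt_pos.2 (bCoeff_pos _ _ _)).ne']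

theorem sum_box_le_norm_berezinKernel_sq {f : ∀ i, PosRegular (n i)} {m : Fin k → ℕ}
    (hm : ∀ i, 1 ≤ m i) {T : ∀ i, Fin (n i) → H →L[ℂ] H} (hT : MemPolydomain f m T) (N : ℕ)
    (h : H) :
    ∑ β ∈ box n N (List.finRange k), ((List.finRange k).map fun i =>
        invCoeff (f i) (m i) (β i)).prod * quad (defectMap f T m 1)
        (((List.finRange k).map fun i => adjoint (wordOp (T i) (β i))).prod h)
      ≤ ‖berezinKernel f m T h‖ ^ 2 := by
  refine le_trans (le_of_eq (Finset.sum_congr rfl fun β _ => ?_))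
    (sum_le_hasSum (box n N (List.finRange k)) (fun β _ => sq_nonneg _)
      (lp_two_hasSum_norm_sq (berezinKernel f m T h)))
  rw [← Fin.prod_univ_def, ← norm_kernelEntry_sq hm hT.defectMap_nonneg,
    (hT.berezinKernel_spec hm).1 h β]
  rfl

end Kernel

/-! ### The square root of a positive operator as an operator with dense range -/

section Sqrt

variable {H : Type u} [NormedAddCommGroup H] [InnerProductSpace ℂ H] [CompleteSpace H]

/-- The range of `A` is contained in that of `A^{1/2}`, because `A = A^{1/2} A^{1/2}`. -/
theorem denseRange_sqrtInto {A : H →L[ℂ] H} (hA : 0 ≤ A) : DenseRange (sqrtInto A) := by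
  intro z
  rw [closure_subtype]
  refine closure_mono ?_ z.2
  rintro _ ⟨x, rfl⟩
  exact ⟨sqrtInto A (opSqrt A x), ⟨opSqrt A x, rfl⟩, opSqrt_opSqrt hA x⟩

theorem adjoint_sqrtInto (A : H →L[ℂ] H) :
    adjoint (sqrtInto A) = opSqrt A ∘L (closedRange A).subtypeL := by
  refine ContinuousLinearMap.ext fun z => ext_inner_left ℂ fun x => ?_
  rw [adjoint_inner_right, comp_apply, ← adjoint_inner_left, adjoint_opSqrt]
  rfl

theorem adjoint_sqrtInto_comp {A : H →L[ℂ] H} (hA : 0 ≤ A) :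
    adjoint (sqrtInto A) ∘L sqrtInto A = A := by
  rw [adjoint_sqrtInto]
  exact ContinuousLinearMap.ext fun x => opSqrt_opSqrt hA x

theorem eq_of_comp_sqrtInto {A : H →L[ℂ] H} (hA : 0 ≤ A) {G : Type*} [NormedAddCommGroup G]
    [InnerProductSpace ℂ G] {B C : closedRange A →L[ℂ] G}
    (h : ∀ x, B (sqrtInto A x) = C (sqrtInto A x)) : B = C :=
  DFunLike.coe_injective ((denseRange_sqrtInto hA).equalizer B.continuous C.continuous (funext h))

end Sqrt

/-! ### The model tuple -/

section Model

variable {k : ℕ} {n : Fin k → ℕ} {H : Type u} [NormedAddCommGroup H] [InnerProductSpace ℂ H]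
  [CompleteSpace H]

theorem defectMap_single (f : ∀ i, PosRegular (n i)) (X : ∀ i, Fin (n i) → H →L[ℂ] H)
    (i : Fin k) (Y : H →L[ℂ] H) :
    defectMap f X (Pi.single i 1) Y = Y - phi (f i) (X i) Y := by
  obtain ⟨s, t, hst⟩ := List.append_of_mem (List.mem_finRange i)
  have hnd : (s ++ i :: t).Nodup := hst ▸ List.nodup_finRange k
  have hs : i ∉ s := fun h => List.disjoint_of_nodup_append hnd h List.mem_cons_self
  have ht : i ∉ t := (List.nodup_cons.1 (List.nodup_append.1 hnd).2.1).1
  change defectFold f X _ (List.finRange k) Y = _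
  rw [hst, defectFold_append, defectFold_cons,
    defectFold_congr f X (q := fun _ => 0) (l := t) (fun i' hi' =>
      Pi.single_eq_of_ne (ne_of_mem_of_not_mem hi' ht) _),
    defectFold_congr f X (q := fun _ => 0) (l := s) (fun i' hi' =>
      Pi.single_eq_of_ne (ne_of_mem_of_not_mem hi' hs) _), defectFold_zero, defectFold_zero,
    Pi.single_eq_same]
  rfl

end Model

/-! ### Compressions of the universal model -/

section Compression

variable {k : ℕ} {n : Fin k → ℕ} {f : ∀ i, PosRegular (n i)} {m : Fin k → ℕ}
  {D M : Type u} [NormedAddCommGroup D] [InnerProductSpace ℂ D] [CompleteSpace D]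
  [NormedAddCommGroup M] [InnerProductSpace ℂ M] [CompleteSpace M]
  {Y : FockTensor n D →L[ℂ] FockTensor n D} {R : FockTensor n D →L[ℂ] M}
  {X : ∀ i, Fin (n i) → M →L[ℂ] M}

/-- The positivity of the defects of `Y` with respect to the universal model. -/
def DefectPositive (f : ∀ i, PosRegular (n i)) (m : Fin k → ℕ)
    (Y : FockTensor n D →L[ℂ] FockTensor n D) : Prop :=
  ∀ p : Fin k → ℕ, p ≤ m → 0 ≤ defectMap f (universalModel f m D) p Y

/-- This is the necessity: `Δ_W^p(Ψ Ψ^*) = Ψ Δ_W^p(I) Ψ^*`. -/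
theorem defectPositive_self_comp_adjoint (hm : ∀ i, 1 ≤ m i) {Ψ : FockTensor n M →L[ℂ] FockTensor n D}
    (hΨ : IsMultiAnalytic f m Ψ) : DefectPositive f m (Ψ ∘L adjoint Ψ) := by
  intro p hp
  have h := defectFold_intertwine hΨ (universalModel_rowContraction f hm)
    (universalModel_rowContraction f hm) p (List.finRange k) 1
  exact (conj_nonneg Ψ (universalModel_defectMap_nonneg f hm hp)).trans_eq h.symm

theorem quad_of_adjoint_comp (hRY : adjoint R ∘L R = Y) (x : FockTensor n D) :
    quad Y x = ‖R x‖ ^ 2 := by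
  rw [← hRY, quad, comp_apply, adjoint_inner_right, inner_self_eq_norm_sq_to_K]
  norm_cast

/-- The tuple `X` on `M` is, up to the closure of the range of `R`, the compression of the universal
model given by `R W_{i,j}^* = X_{i,j}^* R`, where `R^* R = Y` has positive defects. -/
structure IsCompression (f : ∀ i, PosRegular (n i)) (m : Fin k → ℕ)
    (Y : FockTensor n D →L[ℂ] FockTensor n D) (R : FockTensor n D →L[ℂ] M)
    (X : ∀ i, Fin (n i) → M →L[ℂ] M) : Prop where
  defectPositive : DefectPositive f m Y
  denseRange : DenseRange R
  adjoint_comp_self : adjoint R ∘L R = Y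
  apply : ∀ i j x, adjoint (X i j) (R x) = R (adjoint (universalModel f m D i j) x)

theorem DefectPositive.nonneg (h : DefectPositive f m Y) : 0 ≤ Y := by
  have := h (fun _ => 0) fun _ => Nat.zero_le _
  rwa [show defectMap f (universalModel f m D) (fun _ => 0) Y = Y from defectFold_zero _ _ _ _]
    at this

theorem DefectPositive.phi_le (h : DefectPositive f m Y) (hm : ∀ i, 1 ≤ m i) (i : Fin k) :
    phi (f i) (universalModel f m D i) Y ≤ Y := by
  have := h (Pi.single i 1) fun i' => by
    rcases eq_or_ne i' i with rfl | hi
    · simpa using hm i'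
    · simp [hi]
  rwa [defectMap_single, sub_nonneg] at this

theorem DefectPositive.sum_norm_le (h : DefectPositive f m Y) (hm : ∀ i, 1 ≤ m i)
    (hRY : adjoint R ∘L R = Y) (i : Fin k) (F : Finset (List (Fin (n i)))) (x : FockTensor n D) :
    ∑ α ∈ F, (f i).coeff α * ‖R (adjoint (wordOp (universalModel f m D i) α) x)‖ ^ 2
      ≤ ‖R x‖ ^ 2 := by
  simp_rw [← quad_of_adjoint_comp hRY]
  exact (sum_le_hasSum F (fun α _ => mul_nonneg ((f i).coeff_nonneg α) (quad_nonneg h.nonneg _))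
    ((universalModel_rowContraction f hm i).hasSum_quad_phi _ x)).trans
    (quad_mono (h.phi_le hm i) x)

/-- The one-letter term of `Φ(Y) ≤ Y` gives `a_{g_j} ‖R W_{i,j}^* x‖² ≤ ‖R x‖²`. So `R x ↦ R
W_{i,j}^* x` is well defined with bound `a_{g_j}^{-1/2}`, and extends from the dense range of `R`.
-/
theorem DefectPositive.exists_compression (h : DefectPositive f m Y) (hm : ∀ i, 1 ≤ m i)
    (hR : DenseRange R) (hRY : adjoint R ∘L R = Y) (i : Fin k) (j : Fin (n i)) :
    ∃ A : M →L[ℂ] M, ∀ x, A (R x) = R (adjoint (universalModel f m D i j) x) := by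
  have hb : ∀ x, ‖(R ∘L adjoint (universalModel f m D i j)) x‖
      ≤ √(((f i).coeff [j])⁻¹) * ‖R x‖ := by
    intro x
    have h1 := h.sum_norm_le hm hRY i {[j]} x
    rw [Finset.sum_singleton, adjoint_wordOp_cons, adjoint_wordOp_nil] at h1
    have h2 := (f i).coeff_letter_pos j
    rw [← Real.sqrt_sq (norm_nonneg (R x)), ← Real.sqrt_mul (inv_nonneg.2 h2.le)]
    refine Real.le_sqrt_of_sq_le ?_
    rw [inv_mul_eq_div, le_div_iff₀ h2, mul_comm]
    exact h1
  exact ⟨LinearMap.extendOfNorm (R ∘L adjoint (universalModel f m D i j)).toLinearMap R.toLinearMap,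
    fun x => LinearMap.extendOfNorm_eq
      (f := (R ∘L adjoint (universalModel f m D i j)).toLinearMap) (e := R.toLinearMap)
      hR ⟨_, hb⟩ x⟩

namespace IsCompression

theorem intertwine (h : IsCompression f m Y R X) (i : Fin k) (j : Fin (n i)) :
    adjoint R ∘L X i j = universalModel f m D i j ∘L adjoint R := by
  have h1 : adjoint (X i j) ∘L R = R ∘L adjoint (universalModel f m D i j) :=
    ContinuousLinearMap.ext fun x => h.apply i j x
  have h2 := congrArg adjoint h1
  rwa [adjoint_comp, adjoint_comp, adjoint_adjoint, adjoint_adjoint] at h2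

theorem adjoint_wordOp_apply (h : IsCompression f m Y R X) (i : Fin k) (α : List (Fin (n i)))
    (x : FockTensor n D) :
    adjoint (wordOp (X i) α) (R x) = R (adjoint (wordOp (universalModel f m D i) α) x) := by
  have := adjoint_wordOp_intertwine (h.intertwine i) α x
  rw [adjoint_adjoint] at this
  exact this.symm

theorem rowContraction (h : IsCompression f m Y R X) (hm : ∀ i, 1 ≤ m i) (i : Fin k) :
    RowContraction (f i) (X i) := by
  intro z F
  refine h.denseRange.induction_on
    (p := fun z => ∑ α ∈ F, (f i).coeff α * ‖adjoint (wordOp (X i) α) z‖ ^ 2 ≤ ‖z‖ ^ 2) z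
    (isClosed_le (continuous_finsetSum _ fun α _ =>
      ((ContinuousLinearMap.continuous _).norm.pow 2).const_mul _) (continuous_norm.pow 2))
    fun x => ?_
  simp_rw [h.adjoint_wordOp_apply]
  exact h.defectPositive.sum_norm_le hm h.adjoint_comp_self i F x

/-- `R^*` intertwines `X` with the universal model and `R^* I R = Y`, so `Δ_W^p(Y) = R^* Δ_X^p(I)
R`. This transfers positivity to `X`. -/
theorem quad_defectFold (h : IsCompression f m Y R X) (hm : ∀ i, 1 ≤ m i) (p : Fin k → ℕ)
    (l : List (Fin k)) (x : FockTensor n D) :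
    quad (defectFold f X p l 1) (R x) = quad (defectFold f (universalModel f m D) p l Y) x := by
  have h1 := defectFold_intertwine h.intertwine (h.rowContraction hm)
    (universalModel_rowContraction f hm) p l 1
  rw [adjoint_adjoint] at h1
  have h2 : adjoint R ∘L (1 : M →L[ℂ] M) ∘L R = Y := h.adjoint_comp_self
  rw [← h2, h1, quad, quad, comp_apply, comp_apply, adjoint_inner_right]

theorem memPolydomain (h : IsCompression f m Y R X) (hm : ∀ i, 1 ≤ m i) : MemPolydomain f m X where
  commute i i' hi j j' := by
    have h1 : Commute (adjoint (X i j)) (adjoint (X i' j')) := by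
      refine DFunLike.coe_injective (h.denseRange.equalizer (ContinuousLinearMap.continuous _)
        (ContinuousLinearMap.continuous _) (funext fun x => ?_))
      rw [Function.comp_apply, Function.comp_apply, op_mul_apply, op_mul_apply, h.apply, h.apply,
        h.apply, h.apply, universalModel_commute f m hi]
    have h2 := h1.star_star
    rwa [star_eq_adjoint, star_eq_adjoint, adjoint_adjoint, adjoint_adjoint] at h2
  summable i := ((h.rowContraction hm i).hasSum_phiTerm 1).summable
  phi_le_one i := (h.rowContraction hm i).phi_one_le
  defect_nonneg ε := by
    have hp : (fun i => (ε i : ℕ) * m i) ≤ m := fun i =>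
      mul_le_of_le_one_left (Nat.zero_le _) (Nat.lt_succ_iff.1 (ε i).2)
    rw [nonneg_iff_quad]
    refine ⟨defectFold_isSelfAdjoint (h.rowContraction hm) _ _ (IsSelfAdjoint.one _), fun z => ?_⟩
    refine h.denseRange.induction_on
      (p := fun z => 0 ≤ quad (defectMap f X (fun i => (ε i : ℕ) * m i) 1) z) z
      (isClosed_le continuous_const (continuous_quad _)) fun x => ?_
    exact (quad_nonneg (h.defectPositive _ hp) x).trans_eq (h.quad_defectFold hm _ _ x).symm

/-- For truncated `x` the finite sum over the box already recovers `⟨Y x, x⟩ = ‖R x‖²`, and it is a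
partial sum of `‖K_X R x‖²`. -/
theorem norm_apply_le_of_mem_truncated (h : IsCompression f m Y R X) (hm : ∀ i, 1 ≤ m i) {N : ℕ}
    {x : FockTensor n D} (hx : x ∈ truncated n D N) : ‖R x‖ ≤ ‖berezinKernel f m X (R x)‖ := by
  refine (sq_le_sq₀ (norm_nonneg _) (norm_nonneg _)).1
    (le_trans ?_ (sum_box_le_norm_berezinKernel_sq hm (h.memPolydomain hm) N _))
  -- Each single-index step is an equality on truncated vectors; the sign `-1` extracts the lower
  -- bound.
  have h1 := sum_box_quad f m (universalModel f m D) N (-1) Y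
    (truncated n D N) (fun y hy i α => adjoint_wordOp_mem_truncated hy i α)
    (List.finRange k) (List.nodup_finRange k) (fun i l _ y hy => le_of_eq (by
      rw [defectFold_cons, (universalModel_rowContraction f hm i).sum_invCoeff_eq N _ (m i) y
        fun α hα => adjoint_wordOp_eq_zero_of_mem_truncated hy i hα])) x hx
  rw [neg_one_mul, neg_one_mul, neg_le_neg_iff, quad_of_adjoint_comp h.adjoint_comp_self] at h1
  refine h1.trans (le_of_eq (Finset.sum_congr rfl fun β _ => ?_))
  have h2 := prod_adjoint_wordOp_intertwine h.intertwine β (List.finRange k) x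
  rw [adjoint_adjoint] at h2
  rw [← h2]
  exact congrArg _ (h.quad_defectFold hm _ _ _).symm

/-- Berezin kernels are contractive. The reverse inequality extends by continuity twice: from
truncated vectors to all `x`, and from the range of `R` to all of `M`. -/
theorem norm_berezinKernel (h : IsCompression f m Y R X) (hm : ∀ i, 1 ≤ m i) (z : M) :
    ‖berezinKernel f m X z‖ = ‖z‖ := by
  refine le_antisymm (((h.memPolydomain hm).berezinKernel_spec hm).2 z) ?_
  refine h.denseRange.induction_on (p := fun z => ‖z‖ ≤ ‖berezinKernel f m X z‖) z
    (isClosed_le continuous_norm (ContinuousLinearMap.continuous _).norm) fun x => ?_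
  refine isClosed_property (p := fun x => ‖R x‖ ≤ ‖berezinKernel f m X (R x)‖)
    dense_truncated.denseRange_val (isClosed_le R.continuous.norm
      ((berezinKernel f m X).continuous.comp R.continuous).norm) ?_ x
  rintro ⟨x, N, hx⟩
  exact h.norm_apply_le_of_mem_truncated hm hx

theorem isMultiAnalytic (h : IsCompression f m Y R X) (hm : ∀ i, 1 ≤ m i) :
    IsMultiAnalytic f m (adjoint R ∘L adjoint (berezinKernel f m X)) := by
  intro i j
  have h1 := congrArg adjoint (berezinKernel_intertwine hm (h.memPolydomain hm) i j)
  rw [adjoint_comp, adjoint_comp, adjoint_adjoint, adjoint_adjoint] at h1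
  rw [comp_assoc, ← h1, ← comp_assoc, h.intertwine, comp_assoc]

/-- Isometry of the kernel cancels `K_X^* K_X`, leaving `R^* R`. -/
theorem self_comp_adjoint (h : IsCompression f m Y R X) (hm : ∀ i, 1 ≤ m i) :
    (adjoint R ∘L adjoint (berezinKernel f m X)) ∘L
      adjoint (adjoint R ∘L adjoint (berezinKernel f m X)) = Y := by
  have h1 := (norm_map_iff_adjoint_comp_self (berezinKernel f m X)).1 (h.norm_berezinKernel hm)
  rw [adjoint_comp, adjoint_adjoint, adjoint_adjoint, comp_assoc,
    ← comp_assoc _ (berezinKernel _ _ _), h1]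
  exact h.adjoint_comp_self

end IsCompression

end Compression

/-! ### The characteristic function -/

section Characteristic

variable {k : ℕ} {n : Fin k → ℕ} {H : Type u} [NormedAddCommGroup H] [InnerProductSpace ℂ H]
  [CompleteSpace H] {f : ∀ i, PosRegular (n i)} {m : Fin k → ℕ} {T : ∀ i, Fin (n i) → H →L[ℂ] H}

theorem defectPositive_of_hasCharacteristicFunction (hm : ∀ i, 1 ≤ m i)
    (h : HasCharacteristicFunction f m T) : DefectPositive f m (kernelDefect f m T) := by
  obtain ⟨E, _, _, _, Ψ, hΨ, hK⟩ := h
  have hY : kernelDefect f m T = Ψ ∘L adjoint Ψ := by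
    rw [kernelDefect, sub_eq_iff_eq_add', ← hK]
  rw [hY]
  exact defectPositive_self_comp_adjoint hm hΨ

theorem isModelAdjoint_modelTuple (hm : ∀ i, 1 ≤ m i)
    (h : DefectPositive f m (kernelDefect f m T)) (i : Fin k) (j : Fin (n i)) :
    IsModelAdjoint f m T i j (adjoint (modelTuple f m T i j)) := by
  have hex : ∃ A, IsModelAdjoint f m T i j A := h.exists_compression hm
    (denseRange_sqrtInto h.nonneg) (adjoint_sqrtInto_comp h.nonneg) i j
  unfold modelTuple
  rw [dif_pos hex, adjoint_adjoint]
  exact hex.choose_spec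

theorem isCompression_modelTuple (hm : ∀ i, 1 ≤ m i)
    (h : DefectPositive f m (kernelDefect f m T)) :
    IsCompression f m (kernelDefect f m T) (sqrtInto (kernelDefect f m T)) (modelTuple f m T) where
  defectPositive := h
  denseRange := denseRange_sqrtInto h.nonneg
  adjoint_comp_self := adjoint_sqrtInto_comp h.nonneg
  apply i j := isModelAdjoint_modelTuple hm h i j

/-- With `R` the corestriction of `Y^{1/2}`, the adjoint `R^*` is `Y^{1/2}` restricted to the model
space. This brings `Θ` into the form `R^* K_X^*` treated for compressions. -/
theorem theta_eq (f : ∀ i, PosRegular (n i)) (m : Fin k → ℕ) (T : ∀ i, Fin (n i) → H →L[ℂ] H) :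
    theta f m T = adjoint (sqrtInto (kernelDefect f m T)) ∘L
      adjoint (berezinKernel f m (modelTuple f m T)) :=
  congrArg (fun S => S ∘L adjoint (berezinKernel f m (modelTuple f m T)))
    (adjoint_sqrtInto (kernelDefect f m T)).symm

theorem theta_isMultiAnalytic (hm : ∀ i, 1 ≤ m i)
    (h : DefectPositive f m (kernelDefect f m T)) : IsMultiAnalytic f m (theta f m T) := by
  rw [theta_eq]
  exact (isCompression_modelTuple hm h).isMultiAnalytic hm

theorem kernel_add_theta (hm : ∀ i, 1 ≤ m i) (h : DefectPositive f m (kernelDefect f m T)) :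
    berezinKernel f m T ∘L adjoint (berezinKernel f m T)
      + theta f m T ∘L adjoint (theta f m T) = 1 := by
  have h1 : theta f m T ∘L adjoint (theta f m T) = kernelDefect f m T :=
    (congrArg (fun S => S ∘L adjoint S) (theta_eq f m T)).trans
      ((isCompression_modelTuple hm h).self_comp_adjoint hm)
  rw [h1, kernelDefect, add_sub_cancel]

theorem hasCharacteristicFunction_of_defectPositive (hm : ∀ i, 1 ≤ m i)
    (h : DefectPositive f m (kernelDefect f m T)) : HasCharacteristicFunction f m T :=
  ⟨_, _, _, inferInstance, theta f m T, theta_isMultiAnalytic hm h, kernel_add_theta hm h⟩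

end Characteristic

end NCPolydomain

open NCPolydomain
theorem mainTheorem8 {k : ℕ} (hk : 1 ≤ k) (n m : Fin k → ℕ)
    (hn : ∀ i, 1 ≤ n i) (hm : ∀ i, 1 ≤ m i)
    (f : ∀ i, PosRegular (n i))
    {H : Type*} [NormedAddCommGroup H] [InnerProductSpace ℂ H] [CompleteSpace H]
    (T : ∀ i, Fin (n i) → H →L[ℂ] H) (hT : MemPolydomain f m T) :
    IsBerezinKernel f m T (berezinKernel f m T) ∧
    (HasCharacteristicFunction f m T ↔
      ∀ p : Fin k → ℕ, p ≤ m →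
        0 ≤ defectMap f (universalModel f m (defectSpace f m T)) p
          (1 - berezinKernel f m T ∘L ContinuousLinearMap.adjoint (berezinKernel f m T))) ∧
    (HasCharacteristicFunction f m T →
      (∀ i j, IsModelAdjoint f m T i j (ContinuousLinearMap.adjoint (modelTuple f m T i j)) ∧
        ∀ A, IsModelAdjoint f m T i j A →
          A = ContinuousLinearMap.adjoint (modelTuple f m T i j)) ∧
      MemPolydomain f m (modelTuple f m T) ∧
      IsBerezinKernel f m (modelTuple f m T) (berezinKernel f m (modelTuple f m T)) ∧
      IsMultiAnalytic f m (theta f m T) ∧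
      berezinKernel f m T ∘L ContinuousLinearMap.adjoint (berezinKernel f m T)
        + theta f m T ∘L ContinuousLinearMap.adjoint (theta f m T) = 1) := by
  refine ⟨(hT.berezinKernel_spec hm).1, ⟨defectPositive_of_hasCharacteristicFunction hm,
    fun h => hasCharacteristicFunction_of_defectPositive hm h⟩, fun hc => ?_⟩
  have h := defectPositive_of_hasCharacteristicFunction hm hc
  have hM := (isCompression_modelTuple hm h).memPolydomain hm
  refine ⟨fun i j => ⟨isModelAdjoint_modelTuple hm h i j, fun A hA =>
    -- Uniqueness: two candidates agree on the range of `Y^{1/2}`, which is dense in the model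
    -- space.
    eq_of_comp_sqrtInto h.nonneg fun x =>
      (hA x).trans (isModelAdjoint_modelTuple hm h i j x).symm⟩, hM, (hM.berezinKernel_spec hm).1,
    theta_isMultiAnalytic hm h, kernel_add_theta hm h⟩
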